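/- **Conventions.** A smooth manifold is a paracompact Hausdorff space with a smooth atlas (without boundary), of finite dimension. The manifolds $G$ and $M$ below have, as usual, a fixed dimension; in manifolds constructed from them (fixed point sets, loop spaces, disjoint unions) the dimension may vary from component to component. A subset of a manifold carries the subspace topology and the induced smooth structure, in which a map into the subset is smooth iff it is smooth as a map into the ambient manifold; saying that the subset is a manifold means that this structure is that of a manifold. A *Lie groupoid* $\mathcal G$ is a groupoid whose sets of objects $\mathcal G_0$ and arrows $\mathcal G_1$ are smooth manifolds, whose source map $s$ is a submersion, and whose target $t$, unit, inversion and composition are smooth. Its *orbit space* $|\mathcal G|$ is the quotient space of $\mathcal G_0$ in which two objects are identified iff there is an arrow between them. A homomorphism of Lie groupoids is a functor that is smooth on objects and on arrows. A homomorphism $\varphi:\mathcal G\to\mathcal H$ is a *weak equivalence* if (i) $t\circ \mathrm{pr}_2:\mathcal G_0\times_{\mathcal H_0}\mathcal H_1=\{(x,h):\varphi_0(x)=s(h)\}\to\mathcal H_0$ is a surjective submersion, and (ii) $\mathcal G_1$ is, via $((s,t),\varphi_1)$, the fibred product (in manifolds) of $\varphi_0\times\varphi_0:\mathcal G_0\times\mathcal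 G_0\to\mathcal H_0\times\mathcal H_0$ and $(s,t):\mathcal H_1\to\mathcal H_0\times\mathcal H_0$. For a group $G$ acting on $X$, the action groupoid $G\ltimes X$ has objects $X$ and arrows $G\times X$, with $(g,x):x\to gx$. The *inertia groupoid* $\widetilde{\mathcal G}$ of $\mathcal G$ is the action groupoid of $\mathcal G$ acting by conjugation, $\gamma\cdot\delta=\gamma\delta\gamma^{-1}$, on its space of loops $S_{\mathcal G}=\{\delta\in\mathcal G_1: s(\delta)=t(\delta)\}$: its objects are the loops, and its arrows are the pairs $(\gamma,\delta)$ with $s(\gamma)=s(\delta)$, going from $\delta$ to $\gamma\delta\gamma^{-1}$. **Proposition.** Let $G$ be a compact Lie group acting smoothly and almost freely (that is, with finite stabilisers) on a smooth manifold $M$, and let $R\subset G$ be any set containing exactly one element of each conjugacy class of $G$. For $g\in R$ let $Z(g)$ be the centraliser of $g$ in $G$ and $M^g=\{x\in M: gx=x\}$, on which $Z(g)$ acts. Then the inertia groupoid $\widetilde{G\ltimes M}$ and the disjoint union $\bigsqcup_{g\in R}Z(g)\ltimes M^g$ are Lie groupoids, and there is a weak equivalence $$\varphi:\ \bigsqcup_{g\in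 R} Z(g)\ltimes M^g\ \longrightarrow\ \widetilde{G\ltimes M}.$$ Consequently there is a homeomorphism of orbit spaces $$|\widetilde{G\ltimes M}|\ \cong\ \bigsqcup_{g\in R}|Z(g)\ltimes M^g|,$$ and it can be chosen to send the orbit of $\varphi_0(x)$ to the orbit of $x$ in $|Z(g)\ltimes M^g|$, for every $g\in R$ and $x\in M^g$. -/

import Mathlib

open Set Topology Manifold ContDiff Diffeology

set_option linter.checkUnivs false

noncomputable section

/-! ### Smooth spaces

Manifolds, and arbitrary subsets, products and disjoint unions of manifolds, are treated uniformly
as topological spaces carrying a diffeology. Being a smooth manifold is then a property of such a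
space; the connected components of a manifold may have different dimensions. -/

/-- The diffeology of a smooth manifold without boundary modelled on `E`: the plots are the smooth
maps from Euclidean spaces. -/
@[reducible]
def manifoldDiffeology (E : Type*) [NormedAddCommGroup E] [NormedSpace ℝ E]
    (X : Type*) [TopologicalSpace X] [ChartedSpace E X] : DiffeologicalSpace X :=
  .ofCorePlotsOn {
    isPlotOn := fun {n u} _ p => ContMDiffOn 𝓘(ℝ, EuclideanSpace ℝ (Fin n)) 𝓘(ℝ, E) ∞ p u
    isPlotOn_congr := fun _ _ _ h => contMDiffOn_congr h
    isPlot_const := fun _ => contMDiffOn_const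
    isPlotOn_reparam := fun _ _ _ h hp hf => hp.comp hf.contMDiffOn h
    locality := fun _ _ h => fun x hxu => by
      obtain ⟨v, hv, hxv, hv'⟩ := h x hxu
      exact (hv'.contMDiffAt (hv.mem_nhds hxv)).contMDiffWithinAt }

/-- The subspace diffeology. -/
instance subtypeDiffeology {X : Type*} [DiffeologicalSpace X] (s : X → Prop) :
    DiffeologicalSpace (Subtype s) where
  plots _ := {p | IsPlot fun y => (p y : X)}
  constant_plots _ := isPlot_const
  plot_reparam hp hf := isPlot_reparam hp hf
  locality hp := DiffeologicalSpace.locality hp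

/-- The product diffeology. -/
instance prodDiffeology {X Y : Type*} [DiffeologicalSpace X] [DiffeologicalSpace Y] :
    DiffeologicalSpace (X × Y) where
  plots _ := {p | IsPlot (fun y => (p y).1) ∧ IsPlot (fun y => (p y).2)}
  constant_plots _ := ⟨isPlot_const, isPlot_const⟩
  plot_reparam hp hf := ⟨isPlot_reparam hp.1 hf, isPlot_reparam hp.2 hf⟩
  locality hp :=
    ⟨DiffeologicalSpace.locality fun x => by
        obtain ⟨u, hu, hx, h⟩ := hp x
        exact ⟨u, hu, hx, fun hfu hf => (h hfu hf).1⟩,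
      DiffeologicalSpace.locality fun x => by
        obtain ⟨u, hu, hx, h⟩ := hp x
        exact ⟨u, hu, hx, fun hfu hf => (h hfu hf).2⟩⟩

/-- The diffeology of a disjoint union: since Euclidean spaces are connected, a plot of the
disjoint union is a plot of one of the summands. -/
instance sigmaDiffeology {ι : Type*} {X : ι → Type*} [∀ i, DiffeologicalSpace (X i)] :
    DiffeologicalSpace (Σ i, X i) where
  plots n := {p | ∃ (i : ι) (q : EuclideanSpace ℝ (Fin n) → X i), IsPlot q ∧ p = fun y => ⟨i, q y⟩}
  constant_plots x := ⟨x.1, fun _ => x.2, isPlot_const, rfl⟩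
  plot_reparam := by
    rintro n m p f ⟨i, q, hq, rfl⟩ hf
    exact ⟨i, q ∘ f, isPlot_reparam hq hf, rfl⟩
  locality := by
    intro n p hp
    have hloc : IsLocallyConstant fun x => (p x).1 := by
      rw [IsLocallyConstant.iff_eventually_eq]
      intro x
      obtain ⟨u, hu, hxu, h⟩ := hp x
      obtain ⟨ε, hε, hεu⟩ := Metric.isOpen_iff.mp hu x hxu
      have htar := OpenPartialHomeomorph.univBall_target x hε
      obtain ⟨i, q, -, hq⟩ := h (f := OpenPartialHomeomorph.univBall x ε)
        (fun y => hεu (htar ▸ (OpenPartialHomeomorph.univBall x ε).map_source (x := y) (by simp)))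
        OpenPartialHomeomorph.contDiff_univBall
      have key : ∀ y ∈ Metric.ball x ε, (p y).1 = i := by
        intro y hy
        have h2 := congrFun hq ((OpenPartialHomeomorph.univBall x ε).symm y)
        simp only [Function.comp] at h2
        rw [(OpenPartialHomeomorph.univBall x ε).right_inv (by rw [htar]; exact hy)] at h2
        rw [h2]
      filter_upwards [Metric.ball_mem_nhds x hε] with y hy
      rw [key y hy, key x (Metric.mem_ball_self hε)]
    have hc : ∀ x, (p x).1 = (p 0).1 := fun x => hloc.apply_eq_of_preconnectedSpace x 0
    obtain ⟨q, hq⟩ : ∃ q : EuclideanSpace ℝ (Fin n) → X (p 0).1, p = fun y => ⟨(p 0).1, q y⟩ :=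
      ⟨fun y => (hc y) ▸ (p y).2, funext fun y => Sigma.ext (hc y) (by simp)⟩
    refine ⟨_, q, DiffeologicalSpace.locality fun x => ?_, hq⟩
    obtain ⟨u, hu, hxu, h⟩ := hp x
    refine ⟨u, hu, hxu, fun {m f} hfu hf => ?_⟩
    obtain ⟨j, r, hr, hpr⟩ := h hfu hf
    have h0 : ∀ y, (⟨(p 0).1, q (f y)⟩ : Σ i, X i) = ⟨j, r y⟩ := fun y => by
      rw [← congrFun hpr y]; exact (congrFun hq (f y)).symm
    have hj : (p 0).1 = j := congrArg Sigma.fst (h0 0)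
    subst hj
    have : q ∘ f = r := funext fun y => eq_of_heq (Sigma.mk.inj (h0 y)).2
    rw [this]; exact hr

/-- A smooth chart: a homeomorphism from an open subset of `X` onto an open subset of `ℝⁿ` under
which the plots of `X` correspond to the smooth maps. -/
def IsSmoothChart {X : Type*} [TopologicalSpace X] [DiffeologicalSpace X] {n : ℕ}
    (e : OpenPartialHomeomorph X (EuclideanSpace ℝ (Fin n))) : Prop :=
  ∀ (m : ℕ) (p : EuclideanSpace ℝ (Fin m) → X), (∀ y, p y ∈ e.source) →
    (IsPlot p ↔ ContDiff ℝ ∞ (e ∘ p))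

/-- Smooth manifolds: paracompact Hausdorff spaces covered by smooth charts. -/
structure IsSmoothManifold (X : Type*) [TopologicalSpace X] [DiffeologicalSpace X] : Prop where
  t2 : T2Space X
  paracompact : ParacompactSpace X
  dTopology_compatible : IsDTopologyCompatible X
  exists_chart : ∀ x : X, ∃ (n : ℕ) (e : OpenPartialHomeomorph X (EuclideanSpace ℝ (Fin n))),
    IsSmoothChart e ∧ x ∈ e.source

/-- Submersions: smooth maps of manifolds whose derivative, in charts, is everywhere surjective. -/
structure IsSubmersion {X Y : Type*} [TopologicalSpace X] [DiffeologicalSpace X]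
    [TopologicalSpace Y] [DiffeologicalSpace Y] (f : X → Y) : Prop where
  manifold_dom : IsSmoothManifold X
  manifold_cod : IsSmoothManifold Y
  smooth : DSmooth f
  surjective_fderiv : ∀ (n m : ℕ) (e : OpenPartialHomeomorph X (EuclideanSpace ℝ (Fin n)))
    (e' : OpenPartialHomeomorph Y (EuclideanSpace ℝ (Fin m))),
    IsSmoothChart e → IsSmoothChart e' → ∀ x ∈ e.source, f x ∈ e'.source →
      Function.Surjective (fderiv ℝ (e' ∘ f ∘ e.symm) (e x))

/-- Diffeomorphisms. -/
def IsDiffeo {X Y : Type*} [TopologicalSpace X] [DiffeologicalSpace X]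
    [TopologicalSpace Y] [DiffeologicalSpace Y] (f : X → Y) : Prop :=
  ∃ e : X ≃ₜ Y, ⇑e = f ∧ DSmooth e ∧ DSmooth e.symm

/-! ### Lie groupoids -/

/-- A groupoid, given by its structural maps, whose sets of objects and arrows carry topologies and
diffeologies. No smoothness is imposed yet. `comp b a _` is the composite `b ∘ a`. -/
structure DiffGroupoid.{u, v} where
  Obj : Type u
  Arr : Type v
  [topObj : TopologicalSpace Obj]
  [diffObj : DiffeologicalSpace Obj]
  [topArr : TopologicalSpace Arr]
  [diffArr : DiffeologicalSpace Arr]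
  src : Arr → Obj
  tgt : Arr → Obj
  unit : Obj → Arr
  inv : Arr → Arr
  comp : (b a : Arr) → src b = tgt a → Arr
  src_unit : ∀ x, src (unit x) = x
  tgt_unit : ∀ x, tgt (unit x) = x
  src_inv : ∀ a, src (inv a) = tgt a
  tgt_inv : ∀ a, tgt (inv a) = src a
  src_comp : ∀ b a h, src (comp b a h) = src a
  tgt_comp : ∀ b a h, tgt (comp b a h) = tgt b
  comp_assoc : ∀ c b a (hcb : src c = tgt b) (hba : src b = tgt a),
    comp (comp c b hcb) a ((src_comp _ _ _).trans hba) =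
      comp c (comp b a hba) (hcb.trans (tgt_comp _ _ _).symm)
  unit_comp : ∀ a, comp (unit (tgt a)) a (src_unit _) = a
  comp_unit : ∀ a, comp a (unit (src a)) (tgt_unit _).symm = a
  inv_comp : ∀ a, comp (inv a) a (src_inv a) = unit (src a)
  comp_inv : ∀ a, comp a (inv a) (tgt_inv a).symm = unit (tgt a)

attribute [instance] DiffGroupoid.topObj DiffGroupoid.diffObj DiffGroupoid.topArr
  DiffGroupoid.diffArr

namespace DiffGroupoid

lemma inv_unit (𝒢 : DiffGroupoid) (x : 𝒢.Obj) : 𝒢.inv (𝒢.unit x) = 𝒢.unit x := by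
  have h1 := 𝒢.comp_unit (𝒢.inv (𝒢.unit x))
  have h2 := 𝒢.inv_comp (𝒢.unit x)
  simp only [𝒢.src_inv, 𝒢.tgt_unit, 𝒢.src_unit] at h1 h2
  exact h1.symm.trans h2

lemma eq_inv_of_comp_eq_unit (𝒢 : DiffGroupoid) (c d : 𝒢.Arr) (h : 𝒢.src c = 𝒢.tgt d)
    (hcd : 𝒢.comp c d h = 𝒢.unit (𝒢.tgt c)) : d = 𝒢.inv c := by
  have h1 := 𝒢.comp_assoc (𝒢.inv c) c d (𝒢.src_inv c) h
  have h2 := 𝒢.comp_unit (𝒢.inv c)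
  simp only [𝒢.src_inv] at h2
  simp only [𝒢.inv_comp, hcd, h, 𝒢.unit_comp, h2] at h1
  exact h1

lemma inv_of_comp (𝒢 : DiffGroupoid) (b a : 𝒢.Arr) (h : 𝒢.src b = 𝒢.tgt a) :
    𝒢.inv (𝒢.comp b a h) = 𝒢.comp (𝒢.inv a) (𝒢.inv b)
      ((𝒢.src_inv a).trans (h.symm.trans (𝒢.tgt_inv b).symm)) := by
  refine (𝒢.eq_inv_of_comp_eq_unit _ _ (by simp only [𝒢.src_comp, 𝒢.tgt_comp, 𝒢.tgt_inv]) ?_).symm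
  rw [𝒢.comp_assoc b a _ h (by simp only [𝒢.tgt_comp, 𝒢.tgt_inv])]
  have h1 := 𝒢.unit_comp (𝒢.inv b)
  simp only [𝒢.tgt_inv] at h1
  have h2 : 𝒢.comp a (𝒢.comp (𝒢.inv a) (𝒢.inv b)
      ((𝒢.src_inv a).trans (h.symm.trans (𝒢.tgt_inv b).symm)))
      (by simp only [𝒢.tgt_comp, 𝒢.tgt_inv]) = 𝒢.inv b := by
    rw [← 𝒢.comp_assoc a (𝒢.inv a) (𝒢.inv b) (𝒢.tgt_inv a).symm]
    simp only [𝒢.comp_inv, ← h, h1]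
  simp only [h2, 𝒢.comp_inv, 𝒢.tgt_comp]

lemma conj_comp (𝒢 : DiffGroupoid) (b a δ : 𝒢.Arr) (h : 𝒢.src b = 𝒢.tgt a)
    (h₁ : 𝒢.src a = 𝒢.tgt δ) (h₂ : 𝒢.src a = 𝒢.src δ) :
    𝒢.comp (𝒢.comp (𝒢.comp b a h) δ ((𝒢.src_comp _ _ _).trans h₁)) (𝒢.inv (𝒢.comp b a h))
        (by simp only [𝒢.src_comp, 𝒢.tgt_inv, h₂]) =
      𝒢.comp (𝒢.comp b (𝒢.comp (𝒢.comp a δ h₁) (𝒢.inv a)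
          (by simp only [𝒢.src_comp, 𝒢.tgt_inv, h₂])) (by simp only [𝒢.tgt_comp, h])) (𝒢.inv b)
        (by simp only [𝒢.src_comp, 𝒢.src_inv, 𝒢.tgt_inv, h]) := by
  have e₁ := 𝒢.comp_assoc b a δ h h₁
  have e₂ := 𝒢.comp_assoc b (𝒢.comp a δ h₁) (𝒢.inv a) (by simp only [𝒢.tgt_comp, h])
    (by simp only [𝒢.src_comp, 𝒢.tgt_inv, h₂])
  simp only [𝒢.inv_of_comp, e₁]
  rw [← 𝒢.comp_assoc _ (𝒢.inv a) (𝒢.inv b) (by simp only [𝒢.src_comp, 𝒢.tgt_inv, h₂])]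
  simp only [e₂]

/-- Lie groupoids: objects and arrows form smooth manifolds, the source map is a submersion and all
structural maps are smooth. -/
structure IsLie (𝒢 : DiffGroupoid) : Prop where
  manifold_obj : IsSmoothManifold 𝒢.Obj
  manifold_arr : IsSmoothManifold 𝒢.Arr
  submersion_src : IsSubmersion 𝒢.src
  smooth_tgt : DSmooth 𝒢.tgt
  smooth_unit : DSmooth 𝒢.unit
  smooth_inv : DSmooth 𝒢.inv
  smooth_comp : DSmooth fun p : {p : 𝒢.Arr × 𝒢.Arr // 𝒢.src p.1 = 𝒢.tgt p.2} =>
    𝒢.comp p.1.1 p.1.2 p.2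

/-- Two objects are in the same orbit if there is an arrow between them. -/
def orbitSetoid (𝒢 : DiffGroupoid) : Setoid 𝒢.Obj where
  r x y := ∃ a, 𝒢.src a = x ∧ 𝒢.tgt a = y
  iseqv :=
    { refl := fun x => ⟨𝒢.unit x, 𝒢.src_unit x, 𝒢.tgt_unit x⟩
      symm := by
        rintro x y ⟨a, rfl, rfl⟩
        exact ⟨𝒢.inv a, 𝒢.src_inv a, 𝒢.tgt_inv a⟩
      trans := by
        rintro x y z ⟨a, rfl, rfl⟩ ⟨b, hb, rfl⟩
        exact ⟨𝒢.comp b a hb, 𝒢.src_comp _ _ _, 𝒢.tgt_comp _ _ _⟩ }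

/-- The orbit space `|𝒢|`, with the quotient topology. -/
abbrev OrbitSpace (𝒢 : DiffGroupoid) : Type _ := Quotient 𝒢.orbitSetoid

/-- The projection `𝒢₀ → |𝒢|`. -/
def toOrbit (𝒢 : DiffGroupoid) (x : 𝒢.Obj) : 𝒢.OrbitSpace := Quotient.mk _ x

/-- Homomorphisms: functors which are smooth on objects and on arrows. -/
structure Hom (𝒢 ℋ : DiffGroupoid) where
  obj : 𝒢.Obj → ℋ.Obj
  arr : 𝒢.Arr → ℋ.Arr
  smooth_obj : DSmooth obj
  smooth_arr : DSmooth arr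
  src_arr : ∀ a, ℋ.src (arr a) = obj (𝒢.src a)
  tgt_arr : ∀ a, ℋ.tgt (arr a) = obj (𝒢.tgt a)
  arr_unit : ∀ x, arr (𝒢.unit x) = ℋ.unit (obj x)
  arr_comp : ∀ b a (h : 𝒢.src b = 𝒢.tgt a), arr (𝒢.comp b a h) =
    ℋ.comp (arr b) (arr a) ((src_arr b).trans ((congrArg obj h).trans (tgt_arr a).symm))

/-- Weak equivalences of Lie groupoids. -/
structure Hom.IsWeakEquivalence {𝒢 ℋ : DiffGroupoid} (φ : Hom 𝒢 ℋ) : Prop where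
  /-- `t ∘ pr₂ : 𝒢₀ ×_{ℋ₀} ℋ₁ → ℋ₀` is a surjective submersion. -/
  submersion : IsSubmersion fun p : {p : 𝒢.Obj × ℋ.Arr // φ.obj p.1 = ℋ.src p.2} => ℋ.tgt p.1.2
  surjective : Function.Surjective
    fun p : {p : 𝒢.Obj × ℋ.Arr // φ.obj p.1 = ℋ.src p.2} => ℋ.tgt p.1.2
  /-- `𝒢₁` is the fibred product of `𝒢₀ × 𝒢₀` and `ℋ₁` over `ℋ₀ × ℋ₀`. -/
  fibred_product : IsDiffeo fun a : 𝒢.Arr =>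
    (⟨((𝒢.src a, 𝒢.tgt a), φ.arr a), Prod.ext (φ.src_arr a).symm (φ.tgt_arr a).symm⟩ :
      {p : (𝒢.Obj × 𝒢.Obj) × ℋ.Arr // (φ.obj p.1.1, φ.obj p.1.2) = (ℋ.src p.2, ℋ.tgt p.2)})

/-! ### Action groupoids -/

/-- The action groupoid `G ⋉ X` of a group action; the arrow `(g, x)` goes from `x` to `g • x`. -/
@[reducible]
def ofAction (G X : Type*) [Group G] [TopologicalSpace G] [DiffeologicalSpace G]
    [TopologicalSpace X] [DiffeologicalSpace X] [MulAction G X] : DiffGroupoid where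
  Obj := X
  Arr := G × X
  src a := a.2
  tgt a := a.1 • a.2
  unit x := (1, x)
  inv a := (a.1⁻¹, a.1 • a.2)
  comp b a _ := (b.1 * a.1, a.2)
  src_unit _ := rfl
  tgt_unit _ := one_smul _ _
  src_inv _ := rfl
  tgt_inv _ := inv_smul_smul _ _
  src_comp _ _ _ := rfl
  tgt_comp b a h := by simp only [mul_smul, h]
  comp_assoc _ _ _ _ _ := by simp only [mul_assoc]
  unit_comp _ := by simp only [one_mul]
  comp_unit _ := by simp only [mul_one]
  inv_comp _ := by simp only [inv_mul_cancel]
  comp_inv _ := by simp only [mul_inv_cancel]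

/-- A left action of a groupoid on a space `X` along an anchor map. -/
structure LeftAction (𝒢 : DiffGroupoid) (X : Type*) where
  anchor : X → 𝒢.Obj
  act : (a : 𝒢.Arr) → (x : X) → 𝒢.src a = anchor x → X
  anchor_act : ∀ a x h, anchor (act a x h) = 𝒢.tgt a
  unit_act : ∀ x, act (𝒢.unit (anchor x)) x (𝒢.src_unit _) = x
  comp_act : ∀ b a x (h : 𝒢.src b = 𝒢.tgt a) (h' : 𝒢.src a = anchor x),
    act (𝒢.comp b a h) x ((𝒢.src_comp _ _ _).trans h') =
      act b (act a x h') (h.trans (anchor_act _ _ _).symm)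

/-- The action groupoid `𝒢 ⋉ X` of a left action of a groupoid `𝒢`; the arrow `(a, x)` goes from
`x` to `a x`. -/
@[reducible]
def ofLeftAction (𝒢 : DiffGroupoid) {X : Type*} [TopologicalSpace X] [DiffeologicalSpace X]
    (Θ : LeftAction 𝒢 X) : DiffGroupoid where
  Obj := X
  Arr := {p : 𝒢.Arr × X // 𝒢.src p.1 = Θ.anchor p.2}
  src a := a.1.2
  tgt a := Θ.act a.1.1 a.1.2 a.2
  unit x := ⟨(𝒢.unit (Θ.anchor x), x), 𝒢.src_unit _⟩
  inv a := ⟨(𝒢.inv a.1.1, Θ.act a.1.1 a.1.2 a.2),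
    (𝒢.src_inv _).trans (Θ.anchor_act _ _ _).symm⟩
  comp b a h := ⟨(𝒢.comp b.1.1 a.1.1
    (b.2.trans ((congrArg Θ.anchor h).trans (Θ.anchor_act _ _ _))), a.1.2),
    (𝒢.src_comp _ _ _).trans a.2⟩
  src_unit _ := rfl
  tgt_unit x := Θ.unit_act x
  src_inv _ := rfl
  tgt_inv := by
    rintro ⟨⟨a, x⟩, h⟩
    dsimp only at h ⊢
    rw [← Θ.comp_act (𝒢.inv a) a x (𝒢.src_inv a) h]
    simp only [𝒢.inv_comp, h]
    exact Θ.unit_act x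
  src_comp _ _ _ := rfl
  tgt_comp := by
    rintro ⟨⟨b, y⟩, hb⟩ ⟨⟨a, x⟩, ha⟩ h
    dsimp only at h hb ha ⊢
    subst h
    exact Θ.comp_act b a x _ ha
  comp_assoc _ _ _ _ _ := Subtype.ext (Prod.ext (𝒢.comp_assoc _ _ _ _ _) rfl)
  unit_comp := by
    rintro ⟨⟨a, x⟩, h⟩
    refine Subtype.ext (Prod.ext ?_ rfl)
    simp only [Θ.anchor_act]
    exact 𝒢.unit_comp a
  comp_unit := by
    rintro ⟨⟨a, x⟩, h⟩
    refine Subtype.ext (Prod.ext ?_ rfl)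
    dsimp only at h ⊢
    simp only [← h]
    exact 𝒢.comp_unit a
  inv_comp := by
    rintro ⟨⟨a, x⟩, h⟩
    refine Subtype.ext (Prod.ext ?_ rfl)
    dsimp only at h ⊢
    rw [𝒢.inv_comp, h]
  comp_inv := by
    rintro ⟨⟨a, x⟩, h⟩
    refine Subtype.ext (Prod.ext ?_ rfl)
    dsimp only at h ⊢
    rw [𝒢.comp_inv, Θ.anchor_act]

/-! ### The inertia groupoid -/

/-- The space `S_𝒢` of loops in `𝒢`, a subspace of the space of arrows. -/
abbrev Loops (𝒢 : DiffGroupoid) : Type _ := {a : 𝒢.Arr // 𝒢.src a = 𝒢.tgt a}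

/-- The action of `𝒢` on its loops by conjugation: an arrow `γ : x → y` sends a loop `δ` at `x` to
the loop `γ δ γ⁻¹` at `y`. -/
def conjAction (𝒢 : DiffGroupoid) : LeftAction 𝒢 𝒢.Loops where
  anchor δ := 𝒢.src δ.1
  act γ δ h := ⟨𝒢.comp (𝒢.comp γ δ.1 (h.trans δ.2)) (𝒢.inv γ)
      ((𝒢.src_comp _ _ _).trans (h.symm.trans (𝒢.tgt_inv γ).symm)), by
    simp only [𝒢.src_comp, 𝒢.tgt_comp, 𝒢.src_inv]⟩
  anchor_act γ δ h := by simp only [𝒢.src_comp, 𝒢.src_inv]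
  unit_act := by
    rintro ⟨δ, hδ⟩
    refine Subtype.ext ?_
    have h1 : 𝒢.comp (𝒢.unit (𝒢.src δ)) δ ((𝒢.src_unit _).trans hδ) = δ := by
      simp only [hδ]
      exact 𝒢.unit_comp δ
    simp only [𝒢.inv_unit, h1]
    exact 𝒢.comp_unit δ
  comp_act := by
    rintro b a ⟨δ, hδ⟩ h h'
    refine Subtype.ext ?_
    dsimp only at h' ⊢
    exact 𝒢.conj_comp b a δ h (h'.trans hδ) h'

/-- The inertia groupoid: the action groupoid of `𝒢` acting on its loops by conjugation. -/
@[reducible]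
def inertia (𝒢 : DiffGroupoid) : DiffGroupoid := 𝒢.ofLeftAction 𝒢.conjAction

/-! ### Disjoint unions -/

/-- The disjoint union of a family of groupoids. -/
@[reducible]
def disjointUnion {ι : Type*} (𝒢 : ι → DiffGroupoid) : DiffGroupoid where
  Obj := Σ i, (𝒢 i).Obj
  Arr := Σ i, (𝒢 i).Arr
  src a := ⟨a.1, (𝒢 a.1).src a.2⟩
  tgt a := ⟨a.1, (𝒢 a.1).tgt a.2⟩
  unit x := ⟨x.1, (𝒢 x.1).unit x.2⟩
  inv a := ⟨a.1, (𝒢 a.1).inv a.2⟩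
  comp
    | ⟨i, b⟩, ⟨j, a⟩, h => ⟨i, (𝒢 i).comp b ((show j = i from (Sigma.mk.inj h).1.symm) ▸ a) (by
        obtain ⟨h1, h2⟩ := Sigma.mk.inj h
        dsimp only at h1
        subst h1
        exact eq_of_heq h2)⟩
  src_unit x := Sigma.ext rfl (heq_of_eq ((𝒢 x.1).src_unit _))
  tgt_unit x := Sigma.ext rfl (heq_of_eq ((𝒢 x.1).tgt_unit _))
  src_inv x := Sigma.ext rfl (heq_of_eq ((𝒢 x.1).src_inv _))
  tgt_inv x := Sigma.ext rfl (heq_of_eq ((𝒢 x.1).tgt_inv _))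
  src_comp := by
    rintro ⟨i, b⟩ ⟨j, a⟩ h
    obtain rfl : i = j := (Sigma.mk.inj h).1
    exact Sigma.ext rfl (heq_of_eq ((𝒢 i).src_comp _ _ _))
  tgt_comp := by
    rintro ⟨i, b⟩ ⟨j, a⟩ h
    obtain rfl : i = j := (Sigma.mk.inj h).1
    exact Sigma.ext rfl (heq_of_eq ((𝒢 i).tgt_comp _ _ _))
  comp_assoc := by
    rintro ⟨i, c⟩ ⟨j, b⟩ ⟨k, a⟩ h h'
    obtain rfl : i = j := (Sigma.mk.inj h).1
    obtain rfl : i = k := (Sigma.mk.inj h').1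
    exact Sigma.ext rfl (heq_of_eq ((𝒢 i).comp_assoc c b a
      (eq_of_heq (Sigma.mk.inj h).2) (eq_of_heq (Sigma.mk.inj h').2)))
  unit_comp x := Sigma.ext rfl (heq_of_eq ((𝒢 x.1).unit_comp _))
  comp_unit x := Sigma.ext rfl (heq_of_eq ((𝒢 x.1).comp_unit _))
  inv_comp x := Sigma.ext rfl (heq_of_eq ((𝒢 x.1).inv_comp _))
  comp_inv x := Sigma.ext rfl (heq_of_eq ((𝒢 x.1).comp_inv _))

/-! ### Centralisers acting on fixed point sets -/

/-- The action of the centraliser `Z(g)` on the fixed point set `M^g`. -/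
instance centralizerAction (G M : Type*) [Group G] [MulAction G M] (g : G) :
    MulAction (Subgroup.centralizer ({g} : Set G)) (MulAction.fixedBy M g) where
  smul z x := ⟨(z : G) • (x : M), by
    have hz : g * z = z * g := (Subgroup.mem_centralizer_singleton_iff.mp z.2).symm
    have hx : g • (x : M) = x := x.2
    rw [MulAction.mem_fixedBy, ← mul_smul, hz, mul_smul, hx]⟩
  one_smul x := Subtype.ext (one_smul G (x : M))
  mul_smul z w x := Subtype.ext (mul_smul (z : G) (w : G) (x : M))

/-- The action groupoid `Z(g) ⋉ M^g`, with the subspace structures on `Z(g) ⊆ G` and `M^g ⊆ M`. -/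
@[reducible]
def fixedPointGroupoid (G M : Type*) [Group G] [TopologicalSpace G] [DiffeologicalSpace G]
    [TopologicalSpace M] [DiffeologicalSpace M] [MulAction G M] (g : G) : DiffGroupoid :=
  ofAction (Subgroup.centralizer ({g} : Set G)) (MulAction.fixedBy M g)

end DiffGroupoid

end

/-! A loop of `G ⋉ M` is a pair `(h, y)` with `h • y = y`; lying in a finite stabiliser, `h` has
finite order. The functor sends `x ∈ M^g` to the loop `(g, x)`. An arrow `k` from `(g, x)` to `(g',
x')` forces `g' = k g k⁻¹`, so for `g, g' ∈ R` it follows that `g = g'` and `k ∈ Z(g)`; and every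
loop is conjugate to one with first entry in `R`. This is the algebra. The analysis must show that
the spaces involved are manifolds and that the conjugation map `⊔ M^g × G → S`, `(x, k) ↦ (k g k⁻¹,
k x)`, has smooth local sections.

Two facts carry the analysis. First, finite stabilisers are discrete, so orbit maps have injective
derivative at `1`, and an element near `1` fixing a point near `x` is trivial
(`exists_locally_free`). If `g ^ n = 1` and `(h, y)` is a loop near `(g, x)`, then `h ^ n` is near
`1` and fixes `y`, hence `h ^ n = 1` (`exists_pow_eq_one_of_loop`). Second, averaging over iterates
linearises all members `T q` of a smooth family with `(T q)^[n] = id` simultaneously, which gives a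
retraction onto their fixed points depending smoothly on `q`
(`exists_local_retraction_fixedPoints`).

For the action this treats `M^g`, for `k ↦ g k g⁻¹` it treats `Z(g)`, and for `k ↦ q k g⁻¹` it
yields a smooth `σ` with `q = σ(q) g σ(q)⁻¹` whenever `q ^ n = 1` and `q` is near `g`
(`exists_conjugator`). Hence loops near a given one have first entry smoothly conjugate to its own.
This makes `S` a local smooth retract of `G × M`, so a manifold (`IsSmoothManifold.subtype`), and
provides the local sections (`exists_local_section_conjLoop`), from which both the submersion and
the continuity of the inverse map on orbit spaces follow. -/

noncomputable section

/-! ### Plots and charts -/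

/-- A map is smooth on `U` if it sends the plots with values in `U` to plots. -/
def DSmoothOn {X Y : Type*} [DiffeologicalSpace X] [DiffeologicalSpace Y] (f : X → Y)
    (U : Set X) : Prop :=
  ∀ (n : ℕ) (p : EuclideanSpace ℝ (Fin n) → X), IsPlot p → (∀ y, p y ∈ U) → IsPlot (f ∘ p)

section Charts

set_option linter.unusedSectionVars false

variable {X Y : Type*} [TopologicalSpace X] [DiffeologicalSpace X]
  [TopologicalSpace Y] [DiffeologicalSpace Y] {n m : ℕ}

lemma Diffeology.DSmooth.dSmoothOn {f : X → Y} (hf : DSmooth f) (U : Set X) : DSmoothOn f U :=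
  fun n p hp _ => hf n p hp

lemma DSmoothOn.comp {Z : Type*} [DiffeologicalSpace Z] {g : Y → Z} {f : X → Y} {U : Set X}
    {V : Set Y} (hg : DSmoothOn g V) (hf : DSmoothOn f U) (h : MapsTo f U V) :
    DSmoothOn (g ∘ f) U :=
  fun n p hp hU => hg n (f ∘ p) (hf n p hp hU) fun y => h (hU y)

lemma IsSmoothManifold.continuous_plot (hX : IsSmoothManifold X)
    {p : EuclideanSpace ℝ (Fin n) → X} (hp : IsPlot p) : Continuous p := by
  have := hp.continuous
  rwa [hX.dTopology_compatible.dTop_eq] at this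

/-- Plots are defined on whole Euclidean spaces. A local statement is therefore tested on a small
ball, reparametrised by the diffeomorphism `univBall` from the whole space onto that ball. -/
lemma univBall_mem_ball {V : Type*} [NormedAddCommGroup V] [InnerProductSpace ℝ V] (c x : V)
    {r : ℝ} (hr : 0 < r) : OpenPartialHomeomorph.univBall c r x ∈ Metric.ball c r := by
  have := (OpenPartialHomeomorph.univBall c r).map_source (x := x) (by simp)
  rwa [OpenPartialHomeomorph.univBall_target c hr] at this

lemma univBall_right_inv {V : Type*} [NormedAddCommGroup V] [InnerProductSpace ℝ V] (c x : V)
    {r : ℝ} (hr : 0 < r) (hx : x ∈ Metric.ball c r) :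
    OpenPartialHomeomorph.univBall c r ((OpenPartialHomeomorph.univBall c r).symm x) = x :=
  (OpenPartialHomeomorph.univBall c r).right_inv
    (by rwa [OpenPartialHomeomorph.univBall_target c hr])

lemma univBall_symm_contDiffAt {V : Type*} [NormedAddCommGroup V] [InnerProductSpace ℝ V]
    (c : V) {r : ℝ} (hr : 0 < r) :
    ContDiffAt ℝ ∞ (OpenPartialHomeomorph.univBall c r).symm c :=
  OpenPartialHomeomorph.contDiffOn_univBall_symm.contDiffAt (Metric.ball_mem_nhds c hr)

/-- Inverse charts send smooth maps to plots. -/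
lemma IsSmoothChart.isPlot_symm_comp {e : OpenPartialHomeomorph X (EuclideanSpace ℝ (Fin n))}
    (he : IsSmoothChart e) {q : EuclideanSpace ℝ (Fin m) → EuclideanSpace ℝ (Fin n)}
    (hq : ContDiff ℝ ∞ q) (h : ∀ y, q y ∈ e.target) : IsPlot (e.symm ∘ q) := by
  have : e ∘ (e.symm ∘ q) = q := funext fun y => e.right_inv (h y)
  exact (he m (e.symm ∘ q) fun y => e.map_target (h y)).mpr (by rwa [this])

/-- A smooth map is continuous, and smooth in charts. -/
lemma DSmoothOn.contDiffAt_charts {f : X → Y} {U : Set X}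
    (hY : ∀ m (p : EuclideanSpace ℝ (Fin m) → Y), IsPlot p → Continuous p)
    (hf : DSmoothOn f U)
    {e : OpenPartialHomeomorph X (EuclideanSpace ℝ (Fin n))} (he : IsSmoothChart e) {x : X}
    (hU : U ∈ 𝓝 x) (hx : x ∈ e.source) :
    ContinuousAt f x ∧ ∀ {m : ℕ} {e' : OpenPartialHomeomorph Y (EuclideanSpace ℝ (Fin m))},
      IsSmoothChart e' → f x ∈ e'.source → ContDiffAt ℝ ∞ (e' ∘ f ∘ e.symm) (e x) := by
  have hev : ∀ W ∈ 𝓝 x, ∀ᶠ v in 𝓝 (e x), v ∈ e.target ∧ e.symm v ∈ W := fun W hW =>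
    Filter.inter_mem (e.open_target.mem_nhds (e.map_source hx)) (e.tendsto_symm hx hW)
  have key : ∀ W ∈ 𝓝 x, W ⊆ U → ∃ r > 0, (∀ v, OpenPartialHomeomorph.univBall (e x) r v ∈ e.target
      ∧ e.symm (OpenPartialHomeomorph.univBall (e x) r v) ∈ W) ∧
      IsPlot (f ∘ e.symm ∘ OpenPartialHomeomorph.univBall (e x) r) := by
    intro W hW hWU
    obtain ⟨r, hr, hb⟩ := Metric.eventually_nhds_iff_ball.mp (hev W hW)
    have h1 := fun v => hb _ (univBall_mem_ball (e x) v hr)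
    exact ⟨r, hr, h1, hf n _ (he.isPlot_symm_comp OpenPartialHomeomorph.contDiff_univBall
      fun v => (h1 v).1) fun v => hWU (h1 v).2⟩
  have hcont : ContinuousAt f x := by
    obtain ⟨r, hr, h1, hp⟩ := key U hU subset_rfl
    have h2 : ContinuousAt (fun x' => f (e.symm (OpenPartialHomeomorph.univBall (e x) r
        ((OpenPartialHomeomorph.univBall (e x) r).symm (e x'))))) x := by
      refine ContinuousAt.comp (f := fun x' => (OpenPartialHomeomorph.univBall (e x) r).symm (e x'))
        (hY _ _ hp).continuousAt ?_
      exact ContinuousAt.comp (f := e) (univBall_symm_contDiffAt (e x) hr).continuousAt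
        (e.continuousAt hx)
    refine h2.congr ?_
    filter_upwards [e.open_source.mem_nhds hx,
      (e.continuousAt hx).eventually (Metric.ball_mem_nhds (e x) hr)] with x' hx' hx''
    rw [univBall_right_inv _ _ hr hx'', e.left_inv hx']
  refine ⟨hcont, fun {m e'} he' hfx => ?_⟩
  -- Continuity is needed before smoothness: it makes the ball small enough for its image to lie in
  -- the chart `e'`.
  obtain ⟨r, hr, h1, hp⟩ := key (U ∩ f ⁻¹' e'.source)
    (Filter.inter_mem hU (hcont (e'.open_source.mem_nhds hfx))) inter_subset_left
  have h2 : ContDiff ℝ ∞ (e' ∘ f ∘ e.symm ∘ OpenPartialHomeomorph.univBall (e x) r) :=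
    (he' _ _ fun v => (h1 v).2.2).mp hp
  have h3 := h2.contDiffAt.comp (e x) (univBall_symm_contDiffAt (e x) hr)
  refine h3.congr_of_eventuallyEq ?_
  filter_upwards [Metric.ball_mem_nhds (e x) hr] with v hv
  simp only [Function.comp_apply, univBall_right_inv _ _ hr hv]

lemma DSmoothOn.continuousAt (hX : IsSmoothManifold X) (hY : IsSmoothManifold Y) {f : X → Y}
    {U : Set X} (hf : DSmoothOn f U) {x : X} (hU : U ∈ 𝓝 x) : ContinuousAt f x := by
  obtain ⟨n, e, he, hx⟩ := hX.exists_chart x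
  exact (hf.contDiffAt_charts (fun _ _ => hY.continuous_plot) he hU hx).1

/-- Smooth manifolds can be recognised by charts with values in arbitrary finite-dimensional normed
spaces. -/
lemma IsSmoothManifold.of_charts (h2 : T2Space X) (hp : ParacompactSpace X)
    (hc : ∀ n (p : EuclideanSpace ℝ (Fin n) → X), IsPlot p → Continuous p)
    (h : ∀ x : X, ∃ (n : ℕ) (e : OpenPartialHomeomorph X (EuclideanSpace ℝ (Fin n))),
      IsSmoothChart e ∧ x ∈ e.source) : IsSmoothManifold X := by
  refine ⟨h2, hp, ⟨?_⟩, h⟩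
  refine TopologicalSpace.ext_iff.mpr fun u => ?_
  rw [isOpen_iff_preimages_plots]
  -- Charts supply enough plots: a reparametrised ball in the chart at `x` is a plot onto a
  -- neighbourhood of `x`, so a set with open preimages under plots is a neighbourhood of each of
  -- its points.
  refine ⟨fun hu => isOpen_iff_mem_nhds.mpr fun x hx => ?_, fun hu n p hp => hu.preimage (hc n p hp)⟩
  obtain ⟨n, e, he, hxe⟩ := h x
  obtain ⟨r, hr, hb⟩ := Metric.isOpen_iff.mp e.open_target _ (e.map_source hxe)
  have hpl := he.isPlot_symm_comp
    (OpenPartialHomeomorph.contDiff_univBall (c := e x) (r := r)) fun v =>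
      hb (univBall_mem_ball (e x) v hr)
  have ho := hu n _ hpl
  have hcont : ContinuousAt (fun x' => (OpenPartialHomeomorph.univBall (e x) r).symm (e x')) x :=
    ContinuousAt.comp (f := e) (univBall_symm_contDiffAt (e x) hr).continuousAt (e.continuousAt hxe)
  have hmem : (OpenPartialHomeomorph.univBall (e x) r).symm (e x) ∈
      (e.symm ∘ OpenPartialHomeomorph.univBall (e x) r) ⁻¹' u := by
    simp only [mem_preimage, Function.comp_apply,
      univBall_right_inv _ _ hr (Metric.mem_ball_self hr), e.left_inv hxe, hx]
  filter_upwards [hcont (ho.mem_nhds hmem), e.open_source.mem_nhds hxe,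
    (e.continuousAt hxe).eventually (Metric.ball_mem_nhds (e x) hr)] with x' h1 h2 h3
  simpa only [mem_preimage, Function.comp_apply, univBall_right_inv _ _ hr h3, e.left_inv h2]
    using h1

lemma exists_smoothChart_of_model {V : Type*} [NormedAddCommGroup V] [NormedSpace ℝ V]
    [FiniteDimensional ℝ V] (e : OpenPartialHomeomorph X V)
    (he : ∀ (m : ℕ) (p : EuclideanSpace ℝ (Fin m) → X), (∀ y, p y ∈ e.source) →
      (IsPlot p ↔ ContDiff ℝ ∞ (e ∘ p))) {x : X} (hx : x ∈ e.source) :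
    ∃ (n : ℕ) (e : OpenPartialHomeomorph X (EuclideanSpace ℝ (Fin n))),
      IsSmoothChart e ∧ x ∈ e.source := by
  refine ⟨_, e.transHomeomorph (toEuclidean (E := V)).toHomeomorph, fun m p hp => ?_, hx⟩
  rw [he m p hp]
  exact ((toEuclidean (E := V)).comp_contDiff_iff (f := e ∘ p)).symm

/-! ### Submersions -/

/-- A smooth map with smooth local sections through all points is a submersion. -/
lemma IsSubmersion.of_local_sections (hX : IsSmoothManifold X) (hY : IsSmoothManifold Y)
    {f : X → Y} (hf : DSmooth f)
    (h : ∀ x, ∃ (V : Set Y) (s : Y → X), V ∈ 𝓝 (f x) ∧ DSmoothOn s V ∧ s (f x) = x ∧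
      ∀ y ∈ V, f (s y) = y) : IsSubmersion f where
  manifold_dom := hX
  manifold_cod := hY
  smooth := hf
  surjective_fderiv n m e e' he he' x hx hfx := by
    obtain ⟨V, s, hV, hs, hsx, hfs⟩ := h x
    have h1 := ((hf.dSmoothOn univ).contDiffAt_charts (fun _ _ => hY.continuous_plot) he
      Filter.univ_mem hx).2 he' hfx
    obtain ⟨hsc, h2⟩ := hs.contDiffAt_charts (fun _ _ => hX.continuous_plot) he' hV hfx
    have h2 := h2 he (by rwa [hsx])
    have hp : (e ∘ s ∘ e'.symm) (e' (f x)) = e x := by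
      simp only [Function.comp_apply, e'.left_inv hfx, hsx]
    have h3 : (e' ∘ f ∘ e.symm) ∘ (e ∘ s ∘ e'.symm) =ᶠ[𝓝 (e' (f x))] id := by
      have h4 : V ∩ s ⁻¹' e.source ∈ 𝓝 (f x) :=
        Filter.inter_mem hV (hsc (e.open_source.mem_nhds (by rwa [hsx])))
      filter_upwards [(e'.tendsto_symm hfx).eventually h4,
        e'.open_target.mem_nhds (e'.map_source hfx)] with v hv hv'
      simp only [Function.comp_apply, e.left_inv hv.2, hfs _ hv.1, e'.right_inv hv', id]
    -- Differentiating `f ∘ s = id` exhibits a right inverse of the derivative of `f`.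
    have h5 := h3.fderiv_eq (𝕜 := ℝ)
    rw [← hp] at h1
    rw [fderiv_comp _ (h1.differentiableAt (by simp)) (h2.differentiableAt (by simp)), hp,
      fderiv_id] at h5
    intro w
    exact ⟨_, DFunLike.congr_fun h5 w⟩

/-! ### Constructions of manifolds -/

lemma IsDiffeo.isSmoothManifold {f : X → Y} (hf : IsDiffeo f) (hX : IsSmoothManifold X) :
    IsSmoothManifold Y := by
  obtain ⟨g, rfl, hg, hg'⟩ := hf
  have := hX.t2
  have := hX.paracompact
  refine .of_charts g.t2Space ?_ (fun n p hp => ?_) fun y => ?_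
  · exact g.paracompactSpace_iff.mp hX.paracompact
  · have := g.continuous.comp (hX.continuous_plot (hg' n p hp))
    have h : g ∘ g.symm ∘ p = p := funext fun y => g.apply_symm_apply _
    rwa [h] at this
  · obtain ⟨n, e, he, hx⟩ := hX.exists_chart (g.symm y)
    refine ⟨n, g.symm.transOpenPartialHomeomorph e, fun m p hp => ?_, hx⟩
    rw [show (g.symm.transOpenPartialHomeomorph e) ∘ p = e ∘ (g.symm ∘ p) from rfl,
      ← he m (g.symm ∘ p) hp]
    refine ⟨fun h => hg' m p h, fun h => ?_⟩
    have h2 := hg m _ h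
    have h : g ∘ g.symm ∘ p = p := funext fun y => g.apply_symm_apply _
    rwa [h] at h2

lemma IsSmoothManifold.of_isEmpty [IsEmpty X] : IsSmoothManifold X :=
  .of_charts inferInstance ⟨fun _ _ _ _ => ⟨PEmpty, fun x => x.elim, fun x => x.elim,
    eq_univ_of_forall isEmptyElim, fun x => isEmptyElim x, fun x => x.elim⟩⟩
    (fun _ p _ => isEmptyElim (p 0)) isEmptyElim

/-- Paracompactness is a hypothesis because it does not pass to products in general; in the
applications to nonempty products one factor is compact. -/
lemma IsSmoothManifold.prod (hX : IsSmoothManifold X) (hY : IsSmoothManifold Y)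
    (hp : ParacompactSpace (X × Y)) : IsSmoothManifold (X × Y) := by
  have := hX.t2
  have := hY.t2
  refine .of_charts inferInstance hp (fun n p hp => ?_) fun x => ?_
  · exact (hX.continuous_plot hp.1).prodMk (hY.continuous_plot hp.2)
  · obtain ⟨n, e, he, hx⟩ := hX.exists_chart x.1
    obtain ⟨m, e', he', hx'⟩ := hY.exists_chart x.2
    refine exists_smoothChart_of_model (e.prod e') (fun k p hp => ?_) ⟨hx, hx'⟩
    rw [contDiff_prod_iff]
    exact and_congr (he k _ fun y => (hp y).1) (he' k _ fun y => (hp y).2)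

/-- Refine within each summand, keeping the index set of the given cover; the unions over the
summands are locally finite because each summand is open. -/
instance Sigma.paracompactSpace {ι : Type*} {X : ι → Type*} [∀ i, TopologicalSpace (X i)]
    [∀ i, ParacompactSpace (X i)] : ParacompactSpace (Σ i, X i) where
  locallyFinite_refinement α s so su := by
    have h1 := fun i => precise_refinement (fun a => Sigma.mk i ⁻¹' s a)
      (fun a => (so a).preimage continuous_sigmaMk) (by rw [← preimage_iUnion, su, preimage_univ])
    choose t topen tu tf ts using h1
    refine ⟨α, fun a => ⋃ i, Sigma.mk i '' t i a,
      fun a => isOpen_iUnion fun i => isOpenMap_sigmaMk _ (topen i a), ?_, ?_, fun a => ⟨a, ?_⟩⟩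
    · refine eq_univ_of_forall fun ⟨i, x⟩ => ?_
      obtain ⟨a, ha⟩ := mem_iUnion.mp ((tu i).symm ▸ mem_univ x)
      exact mem_iUnion.mpr ⟨a, mem_iUnion.mpr ⟨i, x, ha, rfl⟩⟩
    · rintro ⟨i, x⟩
      obtain ⟨W, hW, hf⟩ := tf i x
      refine ⟨Sigma.mk i '' W, isOpenMap_sigmaMk.image_mem_nhds hW, hf.subset ?_⟩
      rintro a ⟨_, hy, ⟨y, hyW, rfl⟩⟩
      obtain ⟨j, y', hy', heq⟩ := mem_iUnion.mp hy
      obtain ⟨rfl, h⟩ := Sigma.mk.inj heq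
      obtain rfl := eq_of_heq h
      exact ⟨y', hy', hyW⟩
    · refine iUnion_subset fun i => ?_
      rintro _ ⟨y, hy, rfl⟩
      exact ts i a hy

lemma isPlot_sigmaMk {ι : Type*} {X : ι → Type*} [∀ i, DiffeologicalSpace (X i)] (i : ι)
    {p : EuclideanSpace ℝ (Fin n) → X i} : IsPlot (fun y => (⟨i, p y⟩ : Σ i, X i)) ↔ IsPlot p := by
  refine ⟨?_, fun hp => ⟨i, p, hp, rfl⟩⟩
  rintro ⟨j, q, hq, h⟩
  obtain rfl : i = j := (Sigma.mk.inj (congrFun h 0)).1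
  have : p = q := funext fun y => eq_of_heq (Sigma.mk.inj (congrFun h y)).2
  rwa [this]

lemma IsSmoothManifold.sigma {ι : Type*} {X : ι → Type*} [∀ i, TopologicalSpace (X i)]
    [∀ i, DiffeologicalSpace (X i)] (h : ∀ i, IsSmoothManifold (X i)) :
    IsSmoothManifold (Σ i, X i) := by
  have := fun i => (h i).t2
  have := fun i => (h i).paracompact
  refine .of_charts inferInstance inferInstance ?_ ?_
  · rintro n _ ⟨i, q, hq, rfl⟩
    exact continuous_sigmaMk.comp ((h i).continuous_plot hq)
  · rintro ⟨i, x⟩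
    obtain ⟨n, e, he, hx⟩ := (h i).exists_chart x
    have : Nonempty (X i) := ⟨x⟩
    let f : OpenPartialHomeomorph (X i) (Σ i, X i) :=
      IsOpenEmbedding.toOpenPartialHomeomorph (Sigma.mk i) .sigmaMk
    have hf : ∀ y : X i, f.symm ⟨i, y⟩ = y := fun y => f.left_inv (x := y) (by simp [f])
    have hs : ∀ z ∈ (f.symm.trans e).source, ∃ y ∈ e.source, z = ⟨i, y⟩ := by
      intro z hz
      obtain ⟨⟨y, rfl⟩, hz2⟩ : z ∈ range (Sigma.mk i) ∧ _ := by
        simpa [f, OpenPartialHomeomorph.trans_source] using hz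
      refine ⟨y, ?_, rfl⟩
      rw [OpenPartialHomeomorph.trans_source] at hz
      have := hz.2
      rwa [mem_preimage, hf] at this
    refine ⟨n, f.symm.trans e, fun m p hp => ?_, ?_⟩
    · choose q hq hpq using fun y => hs _ (hp y)
      obtain rfl : p = fun y => ⟨i, q y⟩ := funext hpq
      rw [isPlot_sigmaMk, he m q hq]
      have : (f.symm.trans e) ∘ (fun y => (⟨i, q y⟩ : Σ i, X i)) = e ∘ q :=
        funext fun y => congrArg e (hf _)
      rw [this]
    · rw [OpenPartialHomeomorph.trans_source]
      exact ⟨by simp [f], by rwa [mem_preimage, hf]⟩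

end Charts

/-! ### Charted spaces -/

section ManifoldDiffeology

variable {E : Type*} [NormedAddCommGroup E] [NormedSpace ℝ E]
  {X : Type*} [TopologicalSpace X] [ChartedSpace E X] {n : ℕ}

lemma isPlot_manifoldDiffeology {p : EuclideanSpace ℝ (Fin n) → X} :
    letI := manifoldDiffeology E X
    IsPlot p ↔ ContMDiff 𝓘(ℝ, EuclideanSpace ℝ (Fin n)) 𝓘(ℝ, E) ∞ p :=
  contMDiffOn_univ

lemma isSmoothManifold_manifoldDiffeology [FiniteDimensional ℝ E] [IsManifold 𝓘(ℝ, E) ∞ X]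
    [T2Space X] [ParacompactSpace X] :
    letI := manifoldDiffeology E X
    IsSmoothManifold X := by
  let := manifoldDiffeology E X
  refine .of_charts inferInstance inferInstance
    (fun n p hp => (isPlot_manifoldDiffeology.mp hp).continuous) fun x => ?_
  refine exists_smoothChart_of_model (chartAt E x) (fun m p hp => ?_) (mem_chart_source E x)
  rw [isPlot_manifoldDiffeology, ← contMDiff_iff_contDiff]
  refine ⟨fun h => ?_, fun h => ?_⟩
  · exact (contMDiffOn_chart (I := 𝓘(ℝ, E)) (x := x)).comp_contMDiff h hp
  · have h2 := (contMDiffOn_chart_symm (I := 𝓘(ℝ, E)) (n := ∞) (x := x)).comp_contMDiff h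
      fun y => (chartAt E x).map_source (hp y)
    have h3 : (chartAt E x).symm ∘ (chartAt E x) ∘ p = p :=
      funext fun y => (chartAt E x).left_inv (hp y)
    rwa [h3] at h2

variable {F : Type*} [NormedAddCommGroup F] [NormedSpace ℝ F]
  {Y : Type*} [TopologicalSpace Y] [ChartedSpace F Y]
  {D : Type*} [NormedAddCommGroup D] [NormedSpace ℝ D]
  {Z : Type*} [TopologicalSpace Z] [ChartedSpace D Z]

lemma ContMDiffOn.dSmoothOn {f : X → Y} {U : Set X}
    (hf : ContMDiffOn 𝓘(ℝ, E) 𝓘(ℝ, F) ∞ f U) :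
    letI := manifoldDiffeology E X
    letI := manifoldDiffeology F Y
    DSmoothOn f U := by
  let := manifoldDiffeology E X
  let := manifoldDiffeology F Y
  intro n p hp hU
  rw [isPlot_manifoldDiffeology] at hp ⊢
  exact hf.comp_contMDiff hp hU

lemma ContMDiffOn.dSmoothOn_prod {f : X × Y → Z} {U : Set (X × Y)}
    (hf : ContMDiffOn (𝓘(ℝ, E).prod 𝓘(ℝ, F)) 𝓘(ℝ, D) ∞ f U) :
    letI := manifoldDiffeology E X
    letI := manifoldDiffeology F Y
    letI := manifoldDiffeology D Z
    DSmoothOn f U := by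
  let := manifoldDiffeology E X
  let := manifoldDiffeology F Y
  let := manifoldDiffeology D Z
  intro n p hp hU
  rw [isPlot_manifoldDiffeology]
  exact hf.comp_contMDiff ((isPlot_manifoldDiffeology.mp hp.1).prodMk
    (isPlot_manifoldDiffeology.mp hp.2)) hU

end ManifoldDiffeology

/-! ### Smooth retracts -/

/-- The inverse function theorem. -/
lemma exists_local_diffeomorphism {E F : Type*} [NormedAddCommGroup E] [NormedSpace ℝ E]
    [CompleteSpace E] [NormedAddCommGroup F] [NormedSpace ℝ F] {f : E → F} {U : Set E}
    (hU : IsOpen U) (hf : ContDiffOn ℝ ∞ f U) {a : E} (ha : a ∈ U) (f' : E ≃L[ℝ] F)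
    (h : HasFDerivAt f (f' : E →L[ℝ] F) a) :
    ∃ Ψ : OpenPartialHomeomorph E F, a ∈ Ψ.source ∧ Ψ.source ⊆ U ∧ ⇑Ψ = f ∧
      ContDiffOn ℝ ∞ Ψ.symm Ψ.target := by
  have hfa : ContDiffAt ℝ ∞ f a := hf.contDiffAt (hU.mem_nhds ha)
  -- Invertible operators form an open set. Restricting to the points with invertible derivative
  -- makes the inverse smooth on the whole target, not only at the image of `a`.
  have hO : IsOpen (U ∩ fderiv ℝ f ⁻¹' range ((↑) : (E ≃L[ℝ] F) → E →L[ℝ] F)) :=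
    (hf.continuousOn_fderiv_of_isOpen hU (by simp)).isOpen_inter_preimage hU
      ContinuousLinearEquiv.isOpen
  refine ⟨(hfa.toOpenPartialHomeomorph f h (by simp)).restrOpen _ hO,
    ⟨hfa.mem_toOpenPartialHomeomorph_source h (by simp), ha, f', h.fderiv.symm⟩,
    fun x hx => hx.2.1, rfl, fun y hy => ?_⟩
  set Ψ := (hfa.toOpenPartialHomeomorph f h (by simp)).restrOpen _ hO with hΨ
  have hx : Ψ.symm y ∈ Ψ.source := Ψ.map_target hy
  obtain ⟨g, hg⟩ := hx.2.2
  have hfx : ContDiffAt ℝ ∞ f (Ψ.symm y) := hf.contDiffAt (hU.mem_nhds hx.2.1)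
  refine (Ψ.contDiffAt_symm hy (f₀' := g) ?_ hfx).contDiffWithinAt
  rw [hg]
  exact (hfx.differentiableAt (by simp)).hasFDerivAt

/-- A smooth idempotent can be straightened near a fixed point. -/
lemma exists_straightening_idempotent {V : Type*} [NormedAddCommGroup V] [NormedSpace ℝ V]
    [CompleteSpace V] {f : V → V} {D : Set V} (hD : IsOpen D) (hf : ContDiffOn ℝ ∞ f D)
    (hff : ∀ y ∈ D, f y ∈ D ∧ f (f y) = f y) {c : V} (hc : c ∈ D) (hfc : f c = c) :
    ∃ (P : V →L[ℝ] V) (Ψ : OpenPartialHomeomorph V V) (N : Set V),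
      (∀ v, P (P v) = P v) ∧ IsOpen N ∧ c ∈ N ∧ N ⊆ D ∧ N ⊆ Ψ.source ∧
      ContDiffOn ℝ ∞ Ψ D ∧ ContDiffOn ℝ ∞ Ψ.symm Ψ.target ∧
      ∀ y ∈ N, P (Ψ y) = Ψ y ↔ f y = y := by
  set P := fderiv ℝ f c with hP
  have hfd : HasFDerivAt f P c :=
    ((hf.contDiffAt (hD.mem_nhds hc)).differentiableAt (by simp)).hasFDerivAt
  have hPP : P ∘L P = P := by
    have h1 : HasFDerivAt (f ∘ f) (P ∘L P) c := by
      refine HasFDerivAt.comp c ?_ hfd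
      rwa [hfc]
    have h2 : f ∘ f =ᶠ[𝓝 c] f := by
      filter_upwards [hD.mem_nhds hc] with y hy using (hff y hy).2
    exact (h2.hasFDerivAt_iff.mp h1).unique hfd
  have hPP' : ∀ v, P (P v) = P v := fun v => DFunLike.congr_fun hPP v
  -- The map `P (f y - c) + (1 - P) (y - f y)` satisfies `ψ (f y) = P (ψ y)`, and its derivative at
  -- `c` is `P² + (1 - P)² = 1`. So it is a coordinate change turning `f` into the linear projection
  -- `P`.
  set ψ : V → V := fun y => P (f y - c) + ((y - f y) - P (y - f y)) with hψ
  have hψs : ContDiffOn ℝ ∞ ψ D :=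
    (P.contDiff.comp_contDiffOn (hf.sub contDiffOn_const)).add
      ((contDiffOn_id.sub hf).sub (P.contDiff.comp_contDiffOn (contDiffOn_id.sub hf)))
  have hψd : HasFDerivAt ψ ((ContinuousLinearEquiv.refl ℝ V : V ≃L[ℝ] V) : V →L[ℝ] V) c := by
    have h0 := (hasFDerivAt_id c).sub hfd
    have h1 := ((P.hasFDerivAt).comp c (hfd.sub_const c)).add
      (h0.sub ((P.hasFDerivAt).comp c h0))
    refine h1.congr_fderiv ?_
    ext v
    simp [hPP']
  obtain ⟨Ψ, hcΨ, hΨD, hΨ, hΨs⟩ :=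
    exists_local_diffeomorphism hD hψs hc (ContinuousLinearEquiv.refl ℝ V) hψd
  refine ⟨P, Ψ, Ψ.source ∩ f ⁻¹' Ψ.source, hPP',
    (hf.continuousOn.mono hΨD).isOpen_inter_preimage Ψ.open_source Ψ.open_source,
    ⟨hcΨ, by rwa [mem_preimage, hfc]⟩, fun y hy => hΨD hy.1, inter_subset_left, hΨ ▸ hψs, hΨs, ?_⟩
  rintro y ⟨hy, hfy⟩
  rw [hΨ]
  constructor
  · intro h
    -- If the `1 - P` component vanishes, then `ψ (f y) = ψ y`, and injectivity of `Ψ` gives `f y =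
    -- y`.
    have h1 : (y - f y) - P (y - f y) = 0 := by
      have : P (ψ y) = P (f y - c) := by simp only [hψ, map_add, map_sub, hPP']; abel
      rw [this] at h
      simpa [hψ] using h.symm
    refine Ψ.injOn hfy hy ?_
    rw [hΨ]
    simp only [hψ, h1, (hff y (hΨD hy)).2, sub_self, map_zero]
  · intro h
    simp only [hψ, h, sub_self, map_zero, add_zero, hPP']

/-- A closed subset of a manifold which is locally a smooth retract is a manifold. -/
lemma IsSmoothManifold.subtype {X : Type*} [TopologicalSpace X] [DiffeologicalSpace X]
    (hX : IsSmoothManifold X) {A : X → Prop} (hA : IsClosed {x | A x})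
    (h : ∀ x, A x → ∃ (U : Set X) (ρ : X → X), IsOpen U ∧ x ∈ U ∧ DSmoothOn ρ U ∧
      (∀ y ∈ U, A (ρ y)) ∧ ∀ y ∈ U, A y → ρ y = y) : IsSmoothManifold (Subtype A) := by
  have := hX.t2
  have := hX.paracompact
  have hcl : IsClosedEmbedding (Subtype.val : Subtype A → X) := hA.isClosedEmbedding_subtypeVal
  refine .of_charts inferInstance hcl.paracompactSpace
    (fun n p hp => (hX.continuous_plot (p := fun y => (p y : X)) hp).subtype_mk _) ?_
  rintro ⟨x, hx⟩
  obtain ⟨U, ρ, hU, hxU, hρ, hρA, hAρ⟩ := h x hx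
  obtain ⟨n, e, he, hxe⟩ := hX.exists_chart x
  have hρc : ContinuousOn ρ U := fun y hy =>
    (hρ.continuousAt hX hX (hU.mem_nhds hy)).continuousWithinAt
  -- On `W` the point `ρ y` lies again in `U` and in the chart, so `ρ` is idempotent there and can
  -- be read in the single chart `e`.
  set W := U ∩ ρ ⁻¹' (e.source ∩ U) with hW
  have hWo : IsOpen W := hρc.isOpen_inter_preimage hU (e.open_source.inter hU)
  set D := e.target ∩ e.symm ⁻¹' W with hDdef
  have hD : IsOpen D := e.symm.continuousOn.isOpen_inter_preimage e.open_target hWo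
  have hf : ContDiffOn ℝ ∞ (e ∘ ρ ∘ e.symm) D := by
    rintro y ⟨hy, hyW⟩
    have h1 := (hρ.contDiffAt_charts (fun _ _ => hX.continuous_plot) he (hU.mem_nhds hyW.1)
      (e.map_target hy)).2 he hyW.2.1
    rw [e.right_inv hy] at h1
    exact h1.contDiffWithinAt
  have hρρ : ∀ y ∈ W, ρ (ρ y) = ρ y := fun y hy => hAρ _ hy.2.2 (hρA _ hy.1)
  obtain ⟨P, Ψ, N, hPP, hN, hcN, hND, hNΨ, hΨs, hΨs', hΨf⟩ :=
    exists_straightening_idempotent hD hf (c := e x) (by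
      rintro y ⟨hy, hyW⟩
      have h1 : e.symm (e (ρ (e.symm y))) = ρ (e.symm y) := e.left_inv hyW.2.1
      refine ⟨⟨e.map_source hyW.2.1, ?_⟩, ?_⟩
      · simp only [mem_preimage, Function.comp_apply, h1]
        refine ⟨hyW.2.2, ?_⟩
        rw [mem_preimage, hρρ _ hyW]
        exact hyW.2
      · simp only [Function.comp_apply, h1, hρρ _ hyW])
      ⟨e.map_source hxe, by
        simp only [mem_preimage, e.left_inv hxe, hW, mem_inter_iff, hAρ x hxU hx]
        exact ⟨hxU, hxe, hxU⟩⟩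
      (by simp only [Function.comp_apply, e.left_inv hxe, hAρ x hxU hx])
  have hAN : ∀ y ∈ N, (A (e.symm y) ↔ P (Ψ y) = Ψ y) := by
    intro y hy
    rw [hΨf y hy]
    have hyD := hND hy
    simp only [Function.comp_apply]
    constructor
    · intro h
      rw [hAρ _ hyD.2.1 h, e.right_inv hyD.1]
    · intro h
      have h2 : ρ (e.symm y) = e.symm y := by
        rw [← e.left_inv hyD.2.2.1, h]
      rw [← h2]
      exact hρA _ hyD.2.1
  have hPe : ∀ a, A a → a ∈ e.source → e a ∈ N → P (Ψ (e a)) = Ψ (e a) := by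
    intro a ha hae haN
    rw [← hAN _ haN, e.left_inv hae]
    exact ha
  have hPK : ∀ k : LinearMap.range P.toLinearMap, P k = k := by
    rintro ⟨_, v, rfl⟩
    exact hPP v
  have hinv : ∀ k : LinearMap.range P.toLinearMap, (k : EuclideanSpace ℝ (Fin n)) ∈ Ψ.target →
      Ψ.symm k ∈ N → A (e.symm (Ψ.symm k)) := by
    intro k hk hkN
    rw [hAN _ hkN, Ψ.right_inv hk, hPK]
  classical
  -- In the straightened coordinates `Ψ ∘ e` the subset is the range of `P`, which is the model
  -- space of the chart. The value of `inv` outside the chart target is irrelevant.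
  let Q : EuclideanSpace ℝ (Fin n) →L[ℝ] LinearMap.range P.toLinearMap :=
    P.codRestrict _ fun v => ⟨v, rfl⟩
  let inv : LinearMap.range P.toLinearMap → Subtype A := fun k =>
    if h : A (e.symm (Ψ.symm k)) then ⟨_, h⟩ else ⟨x, hx⟩
  have hinv' : ∀ k : LinearMap.range P.toLinearMap, (k : EuclideanSpace ℝ (Fin n)) ∈ Ψ.target →
      Ψ.symm k ∈ N → (inv k : X) = e.symm (Ψ.symm k) := fun k hk hkN => by
    simp only [inv, dif_pos (hinv k hk hkN)]
  let ε : OpenPartialHomeomorph (Subtype A) (LinearMap.range P.toLinearMap) :=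
    { toFun := fun a => Q (Ψ (e a))
      invFun := inv
      source := {a | (a : X) ∈ e.source ∩ e ⁻¹' N}
      target := {k | (k : EuclideanSpace ℝ (Fin n)) ∈ Ψ.target ∩ Ψ.symm ⁻¹' N}
      map_source' := fun a ha => by
        have h1 : ((Q (Ψ (e a)) : _) : EuclideanSpace ℝ (Fin n)) = Ψ (e a) :=
          hPe a a.2 ha.1 ha.2
        simp only [mem_ofPred_eq, h1, mem_inter_iff, mem_preimage, Ψ.left_inv (hNΨ ha.2)]
        exact ⟨Ψ.map_source (hNΨ ha.2), ha.2⟩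
      map_target' := fun k hk => by
        simp only [mem_ofPred_eq, hinv' k hk.1 hk.2, mem_inter_iff, mem_preimage,
          e.right_inv (hND hk.2).1]
        exact ⟨e.map_target (hND hk.2).1, hk.2⟩
      left_inv' := fun a ha => by
        have h1 : ((Q (Ψ (e a)) : _) : EuclideanSpace ℝ (Fin n)) = Ψ (e a) :=
          hPe a a.2 ha.1 ha.2
        refine Subtype.ext ?_
        rw [hinv']
        · rw [h1, Ψ.left_inv (hNΨ ha.2), e.left_inv ha.1]
        · rw [h1]
          exact Ψ.map_source (hNΨ ha.2)
        · rw [h1, Ψ.left_inv (hNΨ ha.2)]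
          exact ha.2
      right_inv' := fun k hk => by
        refine Subtype.ext ?_
        rw [hinv' k hk.1 hk.2, e.right_inv (hND hk.2).1, Ψ.right_inv hk.1]
        exact hPK k
      open_source := (e.continuousOn.isOpen_inter_preimage e.open_source hN).preimage
        continuous_subtype_val
      open_target := (Ψ.symm.continuousOn.isOpen_inter_preimage Ψ.open_target hN).preimage
        continuous_subtype_val
      continuousOn_toFun := by
        refine Q.continuous.comp_continuousOn ?_
        refine (hΨs.continuousOn.comp (e.continuousOn.mono inter_subset_left)
          fun a ha => hND ha.2).comp continuous_subtype_val.continuousOn fun a ha => ha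
      continuousOn_invFun := by
        refine hcl.isInducing.continuousOn_iff.mpr ?_
        have h1 : ContinuousOn (e.symm ∘ Ψ.symm) (Ψ.target ∩ Ψ.symm ⁻¹' N) :=
          e.symm.continuousOn.comp (Ψ.symm.continuousOn.mono inter_subset_left)
            fun k hk => (hND hk.2).1
        exact (h1.comp continuous_subtype_val.continuousOn fun k hk => hk).congr
          fun k hk => hinv' k hk.1 hk.2 }
  refine exists_smoothChart_of_model ε (fun m p hp => ?_) ⟨hxe, hcN⟩
  change IsPlot (fun y => (p y : X)) ↔ ContDiff ℝ ∞ (fun y => Q (Ψ (e (p y))))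
  rw [he m _ fun y => (hp y).1]
  constructor
  · intro h1
    exact Q.contDiff.comp (hΨs.comp_contDiff h1 fun y => hND (hp y).2)
  · intro h1
    have h3 : ∀ y, ((Q (Ψ (e (p y))) : _) : EuclideanSpace ℝ (Fin n)) = Ψ (e (p y)) :=
      fun y => hPe _ (p y).2 (hp y).1 (hp y).2
    have h2 := (Submodule.subtypeL _).contDiff.comp h1
    have h4 := hΨs'.comp_contDiff h2 fun y => by
      rw [Function.comp_apply, Submodule.subtypeL_apply, h3]
      exact Ψ.map_source (hNΨ (hp y).2)
    have h5 : e ∘ (fun y => (p y : X)) = Ψ.symm ∘ ⇑(Submodule.subtypeL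
        (LinearMap.range P.toLinearMap)) ∘ fun y => Q (Ψ (e (p y))) := by
      funext y
      simp only [Function.comp_apply, Submodule.subtypeL_apply, h3, Ψ.left_inv (hNΨ (hp y).2)]
    rw [h5]
    exact h4

/-! ### Local linearisation of families of periodic maps -/

section Linearisation

variable {D : Type*} [NormedAddCommGroup D] [NormedSpace ℝ D] [CompleteSpace D]
  {E : Type*} [NormedAddCommGroup E] [NormedSpace ℝ E] [CompleteSpace E]
  {Q : Type*} [TopologicalSpace Q] [ChartedSpace D Q] [IsManifold 𝓘(ℝ, D) ∞ Q]
  {X : Type*} [TopologicalSpace X] [ChartedSpace E X] [IsManifold 𝓘(ℝ, E) ∞ X]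

/-- The inverse function theorem with parameters. -/
lemma exists_local_inverse_family {V : Type*} [NormedAddCommGroup V] [NormedSpace ℝ V]
    {Ψ : Q × X → V} {U : Set (Q × X)} (hU : IsOpen U)
    (hΨ : ContMDiffOn (𝓘(ℝ, D).prod 𝓘(ℝ, E)) 𝓘(ℝ, V) ∞ Ψ U) {q₀ : Q} {p : X}
    (h₀ : (q₀, p) ∈ U) (Ψ' : E ≃L[ℝ] V)
    (hΨ' : HasFDerivAt (fun y => Ψ (q₀, (chartAt E p).symm y)) (Ψ' : E →L[ℝ] V) (chartAt E p p)) :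
    ∃ (U' : Set (Q × X)) (V' : Set (Q × V)) (Φ : Q × V → X), IsOpen U' ∧ (q₀, p) ∈ U' ∧
      IsOpen V' ∧ (q₀, Ψ (q₀, p)) ∈ V' ∧
      ContMDiffOn (𝓘(ℝ, D).prod 𝓘(ℝ, V)) 𝓘(ℝ, E) ∞ Φ V' ∧
      (∀ z ∈ V', (z.1, Φ z) ∈ U' ∧ Ψ (z.1, Φ z) = z.2) ∧
      ∀ q x x', (q, x) ∈ U' → (q, x') ∈ U' → Ψ (q, x) = Ψ (q, x') → x = x' := by
  set κ := chartAt D q₀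
  set φ := chartAt E p
  have hκ : q₀ ∈ κ.source := mem_chart_source D q₀
  have hφ : p ∈ φ.source := mem_chart_source E p
  set e := κ.prod φ
  set W := e.target ∩ e.symm ⁻¹' U
  have hW : IsOpen W := e.symm.continuousOn.isOpen_inter_preimage e.open_target hU
  have hW₀ : (κ q₀, φ p) ∈ W := by
    refine ⟨e.map_source (x := (q₀, p)) ⟨hκ, hφ⟩, ?_⟩
    have : e.symm (κ q₀, φ p) = (q₀, p) := e.left_inv (x := (q₀, p)) ⟨hκ, hφ⟩
    rwa [mem_preimage, this]
  have hes : ContMDiffOn (𝓘(ℝ, D × E)) (𝓘(ℝ, D).prod 𝓘(ℝ, E)) ∞ e.symm e.target := by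
    refine ContMDiffOn.prodMk ?_ ?_
    · exact (contMDiffOn_chart_symm (I := 𝓘(ℝ, D)) (n := ∞) (x := q₀)).comp
        (contDiff_fst (𝕜 := ℝ) (E := D) (F := E)).contMDiff.contMDiffOn fun z hz => hz.1
    · exact (contMDiffOn_chart_symm (I := 𝓘(ℝ, E)) (n := ∞) (x := p)).comp
        (contDiff_snd (𝕜 := ℝ) (E := D) (F := E)).contMDiff.contMDiffOn fun z hz => hz.2
  have hG : ContDiffOn ℝ ∞ (Ψ ∘ e.symm) W :=
    (hΨ.comp (hes.mono inter_subset_left) fun z hz => hz.2).contDiffOn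
  have hGd : HasFDerivAt (Ψ ∘ e.symm) (fderiv ℝ (Ψ ∘ e.symm) (κ q₀, φ p)) (κ q₀, φ p) :=
    ((hG.contDiffAt (hW.mem_nhds hW₀)).differentiableAt (by simp)).hasFDerivAt
  set G' := fderiv ℝ (Ψ ∘ e.symm) (κ q₀, φ p)
  have hinr : ∀ v, G' (0, v) = Ψ' v := by
    have h1 := hGd.comp (φ p) (hasFDerivAt_prodMk_right (𝕜 := ℝ) (κ q₀) (φ p))
    have h2 : (Ψ ∘ e.symm) ∘ (fun y => (κ q₀, y)) = fun y => Ψ (q₀, φ.symm y) := by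
      funext y
      change Ψ (κ.symm (κ q₀), φ.symm y) = _
      rw [κ.left_inv hκ]
    rw [h2] at h1
    intro v
    simpa using DFunLike.congr_fun (h1.unique hΨ') v
  have hsplit : ∀ u v, G' (u, v) = G' (u, 0) + Ψ' v := fun u v => by
    rw [← hinr v, ← map_add]
    simp
  -- The derivative of `(q, x) ↦ (q, Ψ (q, x))` is block triangular with diagonal blocks `1` and
  -- `Ψ'`; its inverse is `(u, v) ↦ (u, Ψ'⁻¹ (v - G' (u, 0)))`.
  let f' : (D × E) ≃L[ℝ] (D × V) := ContinuousLinearEquiv.equivOfInverse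
    ((ContinuousLinearMap.fst ℝ D E).prod G')
    ((ContinuousLinearMap.fst ℝ D V).prod ((Ψ'.symm : V →L[ℝ] E) ∘L
      (ContinuousLinearMap.snd ℝ D V - G' ∘L (ContinuousLinearMap.inl ℝ D E) ∘L
        ContinuousLinearMap.fst ℝ D V)))
    (fun z => by
      obtain ⟨u, v⟩ := z
      simp [hsplit u v])
    (fun z => by
      obtain ⟨u, v⟩ := z
      refine Prod.ext rfl ?_
      change G' (u, Ψ'.symm (v - G' (u, 0))) = v
      rw [hsplit]
      simp)
  obtain ⟨Θ, h₀Θ, hΘW, hΘ, hΘs⟩ := exists_local_diffeomorphism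
    (f := fun z => (z.1, (Ψ ∘ e.symm) z)) hW (contDiffOn_fst.prodMk hG) hW₀ f'
    ((hasFDerivAt_fst (𝕜 := ℝ) (E := D) (F := E) (p := (κ q₀, φ p))).prodMk hGd)
  set e' := κ.prod (OpenPartialHomeomorph.refl V)
  have hΘsymm : ∀ q v, q ∈ κ.source → (κ q, v) ∈ Θ.target →
      (Θ.symm (κ q, v)).1 = κ q ∧ Ψ (q, φ.symm (Θ.symm (κ q, v)).2) = v ∧
        (Θ.symm (κ q, v)).2 ∈ φ.target := by
    intro q v hq hv
    have h1 := Θ.right_inv hv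
    rw [hΘ, Prod.ext_iff] at h1
    obtain ⟨h1, h2⟩ := h1
    dsimp only at h1 h2
    refine ⟨h1, ?_, (hΘW (Θ.map_target hv)).1.2⟩
    have h3 : e.symm (Θ.symm (κ q, v)) = (q, φ.symm (Θ.symm (κ q, v)).2) := by
      change (κ.symm _, φ.symm _) = _
      rw [h1, κ.left_inv hq]
    rwa [Function.comp_apply, h3] at h2
  refine ⟨e.source ∩ e ⁻¹' Θ.source, e'.source ∩ e' ⁻¹' Θ.target,
    fun z => φ.symm (Θ.symm (κ z.1, z.2)).2, e.continuousOn.isOpen_inter_preimage e.open_source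
    Θ.open_source, ⟨⟨hκ, hφ⟩, h₀Θ⟩, e'.continuousOn.isOpen_inter_preimage e'.open_source
    Θ.open_target, ⟨⟨hκ, trivial⟩, ?_⟩, ?_, ?_, ?_⟩
  · have h1 := Θ.map_source h₀Θ
    rw [hΘ] at h1
    have h2 : e.symm (κ q₀, φ p) = (q₀, p) := e.left_inv (x := (q₀, p)) ⟨hκ, hφ⟩
    simp only [Function.comp_apply, h2] at h1
    exact h1
  · have h1 : ContMDiffOn (𝓘(ℝ, D).prod 𝓘(ℝ, V)) 𝓘(ℝ, D × V) ∞
        (fun z : Q × V => (κ z.1, z.2)) (e'.source ∩ e' ⁻¹' Θ.target) := by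
      rw [modelWithCornersSelf_prod, ← chartedSpaceSelf_prod]
      refine ContMDiffOn.prodMk ?_ contMDiffOn_snd
      exact (contMDiffOn_chart (I := 𝓘(ℝ, D)) (n := ∞) (x := q₀)).comp contMDiffOn_fst
        fun z hz => hz.1.1
    have h2 := (hΘs.snd).contMDiffOn.comp h1 fun z hz => hz.2
    exact (contMDiffOn_chart_symm (I := 𝓘(ℝ, E)) (n := ∞) (x := p)).comp h2
      fun z hz => (hΘsymm z.1 z.2 hz.1.1 hz.2).2.2
  · rintro ⟨q, v⟩ ⟨hq, hv⟩
    obtain ⟨h1, h2, h3⟩ := hΘsymm q v hq.1 hv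
    refine ⟨⟨⟨hq.1, φ.map_target h3⟩, ?_⟩, h2⟩
    change (κ q, φ (φ.symm (Θ.symm (κ q, v)).2)) ∈ Θ.source
    have h4 : (κ q, (Θ.symm (κ q, v)).2) = Θ.symm (κ q, v) := Prod.ext h1.symm rfl
    rw [φ.right_inv h3, h4]
    exact Θ.map_target hv
  · intro q x x' h h' hxx'
    refine φ.injOn h.1.2 h'.1.2 ?_
    have h1 : ∀ x, (q, x) ∈ e.source ∩ e ⁻¹' Θ.source → Θ (κ q, φ x) = (κ q, Ψ (q, x)) := by
      intro x hx
      rw [hΘ]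
      refine Prod.ext rfl ?_
      change Ψ (κ.symm (κ q), φ.symm (φ x)) = _
      rw [κ.left_inv hx.1.1, φ.left_inv hx.1.2]
    have h2 := Θ.injOn h.2 h'.2 (x₁ := e (q, x)) (x₂ := e (q, x'))
      ((h1 x h).trans ((congrArg _ hxx').trans (h1 x' h').symm))
    exact (Prod.mk.inj h2).2

omit [CompleteSpace D] [CompleteSpace E] [IsManifold 𝓘(ℝ, D) ∞ Q] [IsManifold 𝓘(ℝ, E) ∞ X] in
lemma contMDiff_iterate_family {T : Q → X → X}
    (hT : ContMDiff (𝓘(ℝ, D).prod 𝓘(ℝ, E)) 𝓘(ℝ, E) ∞ (fun z : Q × X => T z.1 z.2)) (i : ℕ) :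
    ContMDiff (𝓘(ℝ, D).prod 𝓘(ℝ, E)) 𝓘(ℝ, E) ∞ (fun z : Q × X => (T z.1)^[i] z.2) := by
  induction i with
  | zero => exact contMDiff_snd
  | succ i ih =>
    simp only [Function.iterate_succ_apply']
    exact hT.comp (contMDiff_fst.prodMk ih)

omit [CompleteSpace E] in
-- At a fixed point the chain rule composes the same derivative with itself, so the iterates have
-- derivatives `A ^ i`.
lemma hasFDerivAt_chart_iterate {t : X → X} (ht : ContMDiff 𝓘(ℝ, E) 𝓘(ℝ, E) ∞ t) {p : X}
    (hp : t p = p) : ∃ A : E →L[ℝ] E, ∀ i : ℕ,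
      HasFDerivAt (fun y => chartAt E p (t^[i] ((chartAt E p).symm y))) (A ^ i)
        (chartAt E p p) := by
  set φ := chartAt E p
  have hφ : p ∈ φ.source := mem_chart_source E p
  have hpi : ∀ i, t^[i] p = p := fun i => Function.iterate_fixed hp i
  have hcont : ∀ i, ∀ᶠ y in 𝓝 (φ p), t^[i] (φ.symm y) ∈ φ.source := by
    intro i
    have h1 : ContinuousAt t^[i] p := (ht.continuous.iterate i).continuousAt
    exact (φ.tendsto_symm hφ).eventually
      (h1 (φ.open_source.mem_nhds (by rwa [hpi])))
  have h1 : ContMDiffAt 𝓘(ℝ, E) 𝓘(ℝ, E) ∞ (fun y => φ (t (φ.symm y))) (φ p) := by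
    have h2 : ContMDiffAt 𝓘(ℝ, E) 𝓘(ℝ, E) ∞ φ.symm (φ p) :=
      (contMDiffOn_chart_symm (I := 𝓘(ℝ, E)) (n := ∞) (x := p)).contMDiffAt
        (φ.open_target.mem_nhds (φ.map_source hφ))
    have h3 : ContMDiffAt 𝓘(ℝ, E) 𝓘(ℝ, E) ∞ φ (t (φ.symm (φ p))) := by
      rw [φ.left_inv hφ, hp]
      exact contMDiffAt_of_mem_maximalAtlas (IsManifold.chart_mem_maximalAtlas p) hφ
    exact h3.comp (φ p) (ht.contMDiffAt.comp (φ p) h2)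
  refine ⟨fderiv ℝ (fun y => φ (t (φ.symm y))) (φ p), fun i => ?_⟩
  induction i with
  | zero =>
    refine (hasFDerivAt_id (φ p)).congr_of_eventuallyEq ?_
    filter_upwards [φ.open_target.mem_nhds (φ.map_source hφ)] with y hy using φ.right_inv hy
  | succ i ih =>
    have h2 := (h1.contDiffAt.differentiableAt (by simp)).hasFDerivAt
    have h3 : φ (t^[i] (φ.symm (φ p))) = φ p := by rw [φ.left_inv hφ, hpi]
    have h4 : HasFDerivAt (fun y => φ (t (φ.symm y))) (fderiv ℝ (fun y => φ (t (φ.symm y))) (φ p))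
        (φ (t^[i] (φ.symm (φ p)))) := by rwa [h3]
    rw [pow_succ']
    refine (h4.comp (φ p) ih).congr_of_eventuallyEq ?_
    filter_upwards [hcont i] with y hy
    simp only [Function.comp_apply, Function.iterate_succ_apply', φ.left_inv hy]

end Linearisation

/-! ### Averaging and retractions onto fixed points of periodic maps -/

section Periodic

variable {D : Type*} [NormedAddCommGroup D] [NormedSpace ℝ D] [CompleteSpace D]
  {E : Type*} [NormedAddCommGroup E] [NormedSpace ℝ E] [CompleteSpace E]
  {Q : Type*} [TopologicalSpace Q] [ChartedSpace D Q] [IsManifold 𝓘(ℝ, D) ∞ Q]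
  {X : Type*} [TopologicalSpace X] [ChartedSpace E X] [IsManifold 𝓘(ℝ, E) ∞ X]

/-- Near a fixed point of a periodic member of a smooth family of maps, there is a smooth family of
retractions onto the fixed points of the periodic members of the family. -/
lemma exists_local_retraction_fixedPoints {T : Q → X → X}
    (hT : ContMDiff (𝓘(ℝ, D).prod 𝓘(ℝ, E)) 𝓘(ℝ, E) ∞ (fun z : Q × X => T z.1 z.2))
    {q₀ : Q} {p : X} (hp : T q₀ p = p) {n : ℕ} (hn : 0 < n) (hTn : (T q₀)^[n] = id) :
    ∃ (U : Set (Q × X)) (τ : Q × X → X), IsOpen U ∧ (q₀, p) ∈ U ∧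
      ContMDiffOn (𝓘(ℝ, D).prod 𝓘(ℝ, E)) 𝓘(ℝ, E) ∞ τ U ∧
      ∀ z ∈ U, (T z.1)^[n] = id → T z.1 (τ z) = τ z ∧ (T z.1 z.2 = z.2 → τ z = z.2) := by
  set φ := chartAt E p
  have hφ : p ∈ φ.source := mem_chart_source E p
  have hpi : ∀ i, (T q₀)^[i] p = p := fun i => Function.iterate_fixed hp i
  have hTq : ContMDiff 𝓘(ℝ, E) 𝓘(ℝ, E) ∞ (T q₀) := hT.comp (contMDiff_const.prodMk contMDiff_id)
  have hTi := contMDiff_iterate_family hT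
  obtain ⟨A, hA⟩ := hasFDerivAt_chart_iterate hTq hp
  have hAn : A ^ n = 1 := by
    have h1 := hA n
    rw [hTn] at h1
    refine h1.unique ((hasFDerivAt_id (φ p)).congr_of_eventuallyEq ?_)
    filter_upwards [φ.open_target.mem_nhds (φ.map_source hφ)] with y hy using φ.right_inv hy
  -- Since `A ^ n = 1`, `C i` is `A⁻ⁱ`. Here `A` is the derivative of `T q₀` at `p`; the same `A`
  -- serves for all `q`.
  set C : ℕ → E →L[ℝ] E := fun i => (A ^ (n - 1)) ^ i
  have hAB : A * A ^ (n - 1) = 1 := by rw [← pow_succ', Nat.sub_add_cancel hn, hAn]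
  have hBA : A ^ (n - 1) * A = 1 := by rw [← pow_succ, Nat.sub_add_cancel hn, hAn]
  have hAC : ∀ i, A * C (i + 1) = C i := fun i => by
    simp only [C, pow_succ' _ i, ← mul_assoc, hAB, one_mul]
  have hCn : C n = C 0 := by
    simp only [C, ← pow_mul]
    rw [mul_comm, pow_mul, hAn, one_pow, mul_zero, pow_zero]
  have hCA : ∀ i, C i * A ^ i = 1 := fun i => by
    have hc : Commute (A ^ (n - 1)) A := hBA.trans hAB.symm
    simp only [C]
    rw [← hc.mul_pow, hBA, one_pow]
  -- The average of `A⁻ⁱ ∘ φ ∘ (T q)^i` conjugates every periodic `T q` to the fixed linear map `A`,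
  -- and at `(q₀, p)` its derivative in `x` is the mean of `A⁻ⁱ Aⁱ = 1`. The retraction is then
  -- `Ψ_q⁻¹ ∘ mean ∘ Ψ_q`, where `mean` projects onto the fixed vectors of `A`.
  set Ψ : Q × X → E := fun z =>
    (n : ℝ)⁻¹ • ∑ i ∈ Finset.range n, C i (φ ((T z.1)^[i] z.2))
  set mean : E →L[ℝ] E := (n : ℝ)⁻¹ • ∑ i ∈ Finset.range n, A ^ i
  have hn0 : (n : ℝ) ≠ 0 := by positivity
  have hA_mean : ∀ v, A (mean v) = mean v := by
    have h1 : A * ∑ i ∈ Finset.range n, A ^ i = ∑ i ∈ Finset.range n, A ^ i := by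
      rw [Finset.mul_sum]
      simp only [← pow_succ']
      have h2 := Finset.sum_range_succ' (fun i => A ^ i) n
      rw [Finset.sum_range_succ, hAn, pow_zero] at h2
      exact (add_right_cancel h2).symm
    have h2 : A * mean = mean := by simp only [mean, mul_smul_comm, h1]
    exact fun v => DFunLike.congr_fun h2 v
  have h_mean : ∀ v, A v = v → mean v = v := by
    intro v hv
    have h1 : ∀ i, (A ^ i) v = v := fun i => by
      induction i with
      | zero => rfl
      | succ i ih => rw [pow_succ', mul_apply_eq_comp, ih, hv]
    simp [mean, h1, ← Nat.cast_smul_eq_nsmul ℝ, hn0]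
  have hΨT : ∀ q x, (T q)^[n] x = x → Ψ (q, T q x) = A (Ψ (q, x)) := by
    intro q x hx
    simp only [Ψ, map_smul, map_sum]
    congr 1
    have h1 : ∀ i, C i (φ ((T q)^[i] (T q x))) = A (C (i + 1) (φ ((T q)^[i + 1] x))) := fun i => by
      rw [← hAC i, Function.iterate_succ_apply]
      rfl
    simp only [h1]
    -- The sum is cyclic: the term for `n` equals the term for `0`.
    have h2 := Finset.sum_range_succ' (fun i => A (C i (φ ((T q)^[i] x)))) n
    rw [Finset.sum_range_succ, hx, hCn, Function.iterate_zero_apply] at h2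
    exact (add_right_cancel h2).symm
  set U₀ : Set (Q × X) := ⋂ i ∈ Finset.range n, (fun z : Q × X => (T z.1)^[i] z.2) ⁻¹' φ.source
  have hU₀ : IsOpen U₀ := isOpen_biInter_finset fun i _ =>
    φ.open_source.preimage (hTi i).continuous
  have h₀ : (q₀, p) ∈ U₀ := by
    simp only [U₀, mem_iInter, mem_preimage, hpi]
    exact fun _ _ => hφ
  have hΨs : ContMDiffOn (𝓘(ℝ, D).prod 𝓘(ℝ, E)) 𝓘(ℝ, E) ∞ Ψ U₀ := by
    have h1 : ContMDiffOn (𝓘(ℝ, D).prod 𝓘(ℝ, E)) 𝓘(ℝ, Fin n → E) ∞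
        (fun z : Q × X => fun i : Fin n => φ ((T z.1)^[i] z.2)) U₀ := by
      rw [contMDiffOn_pi_space]
      intro i
      refine (contMDiffOn_chart (I := 𝓘(ℝ, E)) (n := ∞) (x := p)).comp (hTi i).contMDiffOn ?_
      intro z hz
      exact mem_iInter₂.mp hz i (Finset.mem_range.mpr i.2)
    have h2 : ContDiff ℝ ∞ (fun w : Fin n → E => (n : ℝ)⁻¹ • ∑ i : Fin n, C i (w i)) :=
      (ContDiff.sum fun (i : Fin n) _ =>
        (C i).contDiff.comp (contDiff_apply ℝ E i)).const_smul _
    have h3 := h2.contMDiff.comp_contMDiffOn h1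
    refine h3.congr fun z _ => ?_
    simp only [Ψ, Finset.sum_range, Function.comp_apply]
  have hΨd : HasFDerivAt (fun y => Ψ (q₀, φ.symm y))
      ((ContinuousLinearEquiv.refl ℝ E : E ≃L[ℝ] E) : E →L[ℝ] E) (φ p) := by
    have h1 : HasFDerivAt (fun y => (n : ℝ)⁻¹ • ∑ i ∈ Finset.range n,
        C i (φ ((T q₀)^[i] (φ.symm y)))) _ (φ p) :=
      (HasFDerivAt.fun_sum fun i _ => ((C i).hasFDerivAt.comp (φ p) (hA i))).const_smul _
    refine h1.congr_fderiv ?_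
    have h2 : ∀ i, (C i) ∘L (A ^ i) = 1 := hCA
    ext v
    simp [h2, ← Nat.cast_smul_eq_nsmul ℝ, hn0]
  obtain ⟨U, V, Φ, hU, hpU, hV, hpV, hΦ, hΦV, hinj⟩ :=
    exists_local_inverse_family hU₀ hΨs h₀ (ContinuousLinearEquiv.refl ℝ E) hΨd
  have h_mean_p : mean (Ψ (q₀, p)) = Ψ (q₀, p) := by
    refine h_mean _ ?_
    rw [← hΨT q₀ p (hpi n), hp]
  set U₁ : Set (Q × X) := (U ∩ U₀) ∩ (fun z => (z.1, mean (Ψ z))) ⁻¹' V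
  have h_meanΨ : ContMDiffOn (𝓘(ℝ, D).prod 𝓘(ℝ, E)) (𝓘(ℝ, D).prod 𝓘(ℝ, E)) ∞
      (fun z : Q × X => (z.1, mean (Ψ z))) U₀ :=
    contMDiffOn_fst.prodMk (mean.contDiff.contMDiff.comp_contMDiffOn hΨs)
  have hU₁ : IsOpen U₁ := (h_meanΨ.continuousOn.mono inter_subset_right).isOpen_inter_preimage
    (hU.inter hU₀) hV
  have hτ : ContMDiffOn (𝓘(ℝ, D).prod 𝓘(ℝ, E)) 𝓘(ℝ, E) ∞ (fun z => Φ (z.1, mean (Ψ z))) U₁ :=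
    hΦ.comp (h_meanΨ.mono fun z hz => hz.1.2) fun z hz => hz.2
  have hp₁ : (q₀, p) ∈ U₁ := ⟨⟨hpU, h₀⟩, by
    simp only [mem_preimage, h_mean_p]
    exact hpV⟩
  have hτp : Φ (q₀, mean (Ψ (q₀, p))) = p := by
    rw [h_mean_p]
    exact hinj q₀ _ _ (hΦV _ hpV).1 hpU (hΦV _ hpV).2
  -- Equality of the values of `Ψ_q` implies equality of points only inside `U`, so `T q (τ z)` has
  -- to be kept there as well as `τ z`.
  set U₂ : Set (Q × X) := U₁ ∩ (fun z => (z.1, T z.1 (Φ (z.1, mean (Ψ z))))) ⁻¹' U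
  have hTτ : ContinuousOn (fun z : Q × X => (z.1, T z.1 (Φ (z.1, mean (Ψ z))))) U₁ :=
    continuousOn_fst.prodMk (hT.continuous.comp_continuousOn
      (continuousOn_fst.prodMk hτ.continuousOn))
  refine ⟨U₂, fun z => Φ (z.1, mean (Ψ z)), hTτ.isOpen_inter_preimage hU₁ hU, ⟨hp₁, ?_⟩,
    hτ.mono inter_subset_left, ?_⟩
  · simp only [mem_preimage, hτp, hp]
    exact hpU
  · rintro ⟨q, x⟩ ⟨⟨⟨hxU, hxU₀⟩, hxV⟩, hxT⟩ hqn
    obtain ⟨h1, h2⟩ := hΦV _ hxV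
    refine ⟨hinj q _ _ hxT h1 ?_, fun hx => hinj q _ _ h1 hxU ?_⟩
    · dsimp only at h2 ⊢
      rw [hΨT _ _ (congrFun hqn _), h2, hA_mean]
    · dsimp only at h2 ⊢
      rw [h2]
      refine h_mean _ ?_
      rw [← hΨT _ _ (congrFun hqn _)]
      exact congrArg (fun x => Ψ (q, x)) hx

end Periodic

/-! ### Almost free actions -/

section AlmostFree

variable {E : Type*} [NormedAddCommGroup E] [NormedSpace ℝ E] [FiniteDimensional ℝ E]
  {F : Type*} [NormedAddCommGroup F] [NormedSpace ℝ F] [FiniteDimensional ℝ F]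
  {G : Type*} [Group G] [TopologicalSpace G] [ChartedSpace E G] [LieGroup 𝓘(ℝ, E) ∞ G]
  {M : Type*} [TopologicalSpace M] [ChartedSpace F M] [IsManifold 𝓘(ℝ, F) ∞ M]
  [MulAction G M] [ContMDiffSMul 𝓘(ℝ, E) 𝓘(ℝ, F) ∞ G M]

omit [FiniteDimensional ℝ E] [FiniteDimensional ℝ F] [LieGroup 𝓘(ℝ, E) ∞ G]
  [IsManifold 𝓘(ℝ, F) ∞ M] in
lemma contMDiff_orbitMap (x : M) : ContMDiff 𝓘(ℝ, E) 𝓘(ℝ, F) ∞ (fun k : G => k • x) :=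
  (ContMDiffSMul.contMDiff_smul (I := 𝓘(ℝ, E)) (I' := 𝓘(ℝ, F))).comp
    (contMDiff_id.prodMk contMDiff_const)

lemma contMDiff_smul_left (E : Type*) [NormedAddCommGroup E] [NormedSpace ℝ E]
    {F : Type*} [NormedAddCommGroup F] [NormedSpace ℝ F]
    {G : Type*} [Group G] [TopologicalSpace G] [ChartedSpace E G]
    {M : Type*} [TopologicalSpace M] [ChartedSpace F M]
    [MulAction G M] [ContMDiffSMul 𝓘(ℝ, E) 𝓘(ℝ, F) ∞ G M] (k : G) :
    ContMDiff 𝓘(ℝ, F) 𝓘(ℝ, F) ∞ (fun x : M => k • x) :=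
  (ContMDiffSMul.contMDiff_smul (I := 𝓘(ℝ, E)) (I' := 𝓘(ℝ, F))).comp
    (contMDiff_const.prodMk contMDiff_id)

omit [FiniteDimensional ℝ E] [FiniteDimensional ℝ F] [IsManifold 𝓘(ℝ, F) ∞ M] in
/-- If the derivative of an orbit map kills a vector, it kills the left-invariant vector field. -/
lemma mfderiv_orbitMap_mulInvariantVectorField (x : M) (v : GroupLieAlgebra 𝓘(ℝ, E) G)
    (hv : mfderiv 𝓘(ℝ, E) 𝓘(ℝ, F) (fun k : G => k • x) 1 v = 0) (k : G) :
    mfderiv 𝓘(ℝ, E) 𝓘(ℝ, F) (fun k : G => k • x) k (mulInvariantVectorField v k) = 0 := by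
  have h1 : (fun k : G => k • x) ∘ (k * ·) = (k • ·) ∘ (fun k : G => k • x) :=
    funext fun l => mul_smul k l x
  have hf : ∀ k, MDifferentiableAt 𝓘(ℝ, E) 𝓘(ℝ, F) (fun k : G => k • x) k :=
    fun k => (contMDiff_orbitMap x).mdifferentiable (by simp) k
  have hm : MDifferentiableAt 𝓘(ℝ, E) 𝓘(ℝ, E) (k * ·) (1 : G) :=
    (contMDiff_mul_left (I := 𝓘(ℝ, E)) (n := ∞)).mdifferentiable (by simp) 1
  have hk : MDifferentiableAt 𝓘(ℝ, F) 𝓘(ℝ, F) (fun y : M => k • y) ((1 : G) • x) :=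
    (contMDiff_smul_left E k).mdifferentiable (by simp) _
  have h2 := mfderiv_comp_of_eq (hf k) hm (mul_one k)
  have h3 := mfderiv_comp 1 hk (hf 1)
  have h4 : (mfderiv 𝓘(ℝ, E) 𝓘(ℝ, F) ((fun k : G => k • x) ∘ (k * ·)) 1 : E →L[ℝ] F) v = 0 := by
    rw [h1]
    exact (DFunLike.congr_fun h3 v).trans
      ((congrArg (mfderiv 𝓘(ℝ, F) 𝓘(ℝ, F) (fun y : M => k • y) ((1 : G) • x)) hv).trans
        (map_zero (mfderiv 𝓘(ℝ, F) 𝓘(ℝ, F) (fun y : M => k • y) ((1 : G) • x))))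
  have h5 : ∀ k', k' = k → (mfderiv 𝓘(ℝ, E) 𝓘(ℝ, F) (fun k : G => k • x) k' : E →L[ℝ] F) =
      (mfderiv 𝓘(ℝ, E) 𝓘(ℝ, F) (fun k : G => k • x) k : E →L[ℝ] F) := by
    rintro _ rfl
    rfl
  exact (DFunLike.congr_fun (h5 (k * 1) (mul_one k)) _).symm.trans
    ((DFunLike.congr_fun h2 v).symm.trans h4)

omit [FiniteDimensional ℝ F] in
/-- If a stabiliser is finite, the derivative of the orbit map at the identity is injective. -/
lemma mfderiv_orbitMap_injective [T2Space G] (x : M) (hx : Finite (MulAction.stabilizer G x))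
    (v : GroupLieAlgebra 𝓘(ℝ, E) G)
    (hv : mfderiv 𝓘(ℝ, E) 𝓘(ℝ, F) (fun k : G => k • x) 1 v = 0) : v = 0 := by
  have : LieGroup 𝓘(ℝ, E) (minSmoothness ℝ 3) G := LieGroup.of_le (n := ∞) (by
    rw [minSmoothness_of_isRCLikeNormedField]
    exact WithTop.coe_le_coe.mpr (le_top : (3 : ℕ∞) ≤ ⊤))
  have : IsManifold 𝓘(ℝ, E) 1 G := IsManifold.of_le (n := ∞) (by simp)
  have : CompleteSpace E := FiniteDimensional.complete ℝ E
  -- Follow the integral curve `γ` of the left-invariant field of `v` through `1`. The curve `γ t •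
  -- x` has zero derivative, so it is constant and `γ` stays in the stabiliser. That group is
  -- finite, hence `γ` is constant near `0` and `v = γ'(0) = 0`.
  have hs := (contMDiff_mulInvariantVectorField (I := 𝓘(ℝ, E)) v).contMDiffAt (x := (1 : G))
  obtain ⟨γ, hγ1, hγ⟩ := exists_isMIntegralCurveAt_of_contMDiffAt_boundaryless (t₀ := 0)
    (hs.of_le (by rw [minSmoothness_of_isRCLikeNormedField]; norm_num))
  have hγc : ContinuousAt γ 0 := hγ.continuousAt
  set φ := chartAt F x
  have hφ : x ∈ φ.source := mem_chart_source F x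
  have hγx : ContinuousAt (fun t => γ t • x) 0 :=
    (contMDiff_orbitMap (E := E) (F := F) x).continuous.continuousAt.comp hγc
  have hφγ : ∀ᶠ t in 𝓝 (0 : ℝ), γ t • x ∈ φ.source :=
    hγx (φ.open_source.mem_nhds (by simpa only [hγ1, one_smul] using hφ))
  have hder : ∀ᶠ t in 𝓝 (0 : ℝ), HasFDerivAt (fun t => φ (γ t • x)) (0 : ℝ →L[ℝ] F) t := by
    filter_upwards [hγ, hφγ] with t ht ht'
    have h1 : MDifferentiableAt 𝓘(ℝ, E) 𝓘(ℝ, F) (fun k : G => k • x) (γ t) :=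
      (contMDiff_orbitMap x).mdifferentiable (by simp) _
    have h2 : MDifferentiableAt 𝓘(ℝ, F) 𝓘(ℝ, F) φ (γ t • x) :=
      (contMDiffAt_of_mem_maximalAtlas (n := ∞) (IsManifold.chart_mem_maximalAtlas x)
        ht').mdifferentiableAt (by simp)
    have h3 := h2.hasMFDerivAt.comp t (h1.hasMFDerivAt.comp t ht)
    refine (hasMFDerivAt_iff_hasFDerivAt.mp h3).congr_fderiv ?_
    have h4 := mfderiv_orbitMap_mulInvariantVectorField x v hv (γ t)
    have h5 : ∀ (P : F →L[ℝ] F) (B : E →L[ℝ] F) (w : E), B w = 0 →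
        P ∘L (B ∘L (1 : ℝ →L[ℝ] ℝ).smulRight w) = 0 := fun P B w hw => by ext; simp [hw]
    exact h5 _ _ _ h4
  obtain ⟨r, hr, hball⟩ := Metric.eventually_nhds_iff_ball.mp hder
  have hconst : ∀ t ∈ Metric.ball (0 : ℝ) r, φ (γ t • x) = φ (γ 0 • x) := by
    intro t ht
    exact Metric.isOpen_ball.is_const_of_fderiv_eq_zero (𝕜 := ℝ)
      (convex_ball _ _).isPreconnected
      (fun t ht => (hball t ht).differentiableAt.differentiableWithinAt)
      (fun t ht => (hball t ht).fderiv) ht (Metric.mem_ball_self hr)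
  have hstab : ∀ᶠ t in 𝓝 (0 : ℝ), γ t ∈ MulAction.stabilizer G x := by
    filter_upwards [Metric.ball_mem_nhds 0 hr, hφγ] with t ht ht'
    have h1 := hconst t ht
    rw [hγ1, one_smul] at h1
    exact φ.injOn ht' hφ h1
  have hfin : ((MulAction.stabilizer G x : Set G) \ {1}).Finite := (Set.toFinite _).subset sdiff_subset
  have hone : ∀ᶠ t in 𝓝 (0 : ℝ), γ t = 1 := by
    filter_upwards [hstab, hγc (hfin.isClosed.isOpen_compl.mem_nhds
      (by rw [hγ1]; simp))] with t ht ht'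
    by_contra hne
    exact ht' ⟨ht, hne⟩
  have h1 := hγ.hasMFDerivAt
  have h2 : HasMFDerivAt 𝓘(ℝ, ℝ) 𝓘(ℝ, E) γ 0 (0 : ℝ →L[ℝ] E) := by
    have h3 : HasMFDerivAt 𝓘(ℝ, ℝ) 𝓘(ℝ, E) (fun _ : ℝ => (1 : G)) 0 (0 : ℝ →L[ℝ] E) :=
      hasMFDerivAt_const _ _
    exact h3.congr_of_eventuallyEq hone
  have h3 := DFunLike.congr_fun (hasMFDerivAt_unique h1 h2) (1 : ℝ)
  have h4 : mulInvariantVectorField v (γ 0) = 0 := (one_smul ℝ _).symm.trans h3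
  rw [hγ1] at h4
  have h5 : mulInvariantVectorField v (1 : G) = v := by
    have : ((1 : G) * ·) = id := funext one_mul
    simp only [mulInvariantVectorField]
    rw [this, mfderiv_id]
    rfl
  rwa [h5] at h4

/-- An almost free action is locally free. -/
lemma exists_locally_free (E F : Type*) [NormedAddCommGroup E] [NormedSpace ℝ E]
    [FiniteDimensional ℝ E] [NormedAddCommGroup F] [NormedSpace ℝ F] [FiniteDimensional ℝ F]
    {G : Type*} [Group G] [TopologicalSpace G] [ChartedSpace E G] [LieGroup 𝓘(ℝ, E) ∞ G]
    {M : Type*} [TopologicalSpace M] [ChartedSpace F M] [IsManifold 𝓘(ℝ, F) ∞ M]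
    [MulAction G M] [ContMDiffSMul 𝓘(ℝ, E) 𝓘(ℝ, F) ∞ G M] [T2Space G] (x : M) (hx : Finite (MulAction.stabilizer G x)) :
    ∃ U : Set (G × M), IsOpen U ∧ ((1 : G), x) ∈ U ∧
      ∀ k x', (k, x') ∈ U → k • x' = x' → k = 1 := by
  have : CompleteSpace E := FiniteDimensional.complete ℝ E
  have : CompleteSpace F := FiniteDimensional.complete ℝ F
  set φ := chartAt F ((1 : G) • x)
  set χ := chartAt E (1 : G)
  have hf : MDifferentiableAt 𝓘(ℝ, E) 𝓘(ℝ, F) (fun k : G => k • x) 1 :=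
    (contMDiff_orbitMap x).mdifferentiable (by simp) _
  obtain ⟨D, hD, hDinj⟩ : ∃ D : E →L[ℝ] F,
      HasFDerivAt (fun y => φ (χ.symm y • x)) D (χ 1) ∧ ∀ v, D v = 0 → v = 0 := by
    have h1 := hf.hasMFDerivAt.2
    simp only [writtenInExtChartAt, mfld_simps] at h1
    exact ⟨_, h1.hasFDerivAt Filter.univ_mem, mfderiv_orbitMap_injective x hx⟩
  obtain ⟨L, hL⟩ := D.toLinearMap.exists_leftInverse_of_injective
    (LinearMap.ker_eq_bot'.mpr hDinj)
  -- With a linear left inverse `L` of the derivative of the orbit map, `k ↦ L (φ (k • x'))` is a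
  -- family of maps on `G` with parameter `x' ∈ M`, having derivative `1` at `k = 1` for `x' = x`.
  -- Hence it is injective in `k` nearby, and `k • x' = 1 • x'` gives `k = 1`.
  set Ψ : M × G → E := fun z => L.toContinuousLinearMap (φ (z.2 • z.1))
  have hsm : ContMDiff (𝓘(ℝ, F).prod 𝓘(ℝ, E)) 𝓘(ℝ, F) ∞ (fun z : M × G => z.2 • z.1) :=
    (ContMDiffSMul.contMDiff_smul (I := 𝓘(ℝ, E)) (I' := 𝓘(ℝ, F))).comp
      (contMDiff_snd.prodMk contMDiff_fst)
  have hΨ : ContMDiffOn (𝓘(ℝ, F).prod 𝓘(ℝ, E)) 𝓘(ℝ, E) ∞ Ψ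
      ((fun z : M × G => z.2 • z.1) ⁻¹' φ.source) :=
    L.toContinuousLinearMap.contDiff.contMDiff.comp_contMDiffOn
      ((contMDiffOn_chart (I := 𝓘(ℝ, F)) (n := ∞)).comp hsm.contMDiffOn fun z hz => hz)
  have hΨd : HasFDerivAt (fun y => Ψ (x, χ.symm y))
      ((ContinuousLinearEquiv.refl ℝ E : E ≃L[ℝ] E) : E →L[ℝ] E) (χ 1) := by
    refine (L.toContinuousLinearMap.hasFDerivAt.comp (χ 1) hD).congr_fderiv ?_
    ext v
    exact LinearMap.congr_fun hL v
  obtain ⟨U, -, -, hU, h1U, -, -, -, -, hinj⟩ := exists_local_inverse_family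
    (φ.open_source.preimage hsm.continuous) hΨ (q₀ := x) (p := (1 : G))
    (mem_chart_source F ((1 : G) • x)) (ContinuousLinearEquiv.refl ℝ E) hΨd
  refine ⟨{z | (z.2, z.1) ∈ U ∧ (z.2, 1) ∈ U}, ?_, ⟨h1U, h1U⟩, fun k x' h hk => ?_⟩
  · exact (hU.preimage (continuous_snd.prodMk continuous_fst)).inter
      (hU.preimage (continuous_snd.prodMk continuous_const))
  · refine hinj x' k 1 h.1 h.2 ?_
    simp only [Ψ, hk, one_smul]

end AlmostFree

/-! ### Fixed point sets, centralisers and loops -/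

section Loops

variable {E : Type*} [NormedAddCommGroup E] [NormedSpace ℝ E] [FiniteDimensional ℝ E]
  {F : Type*} [NormedAddCommGroup F] [NormedSpace ℝ F] [FiniteDimensional ℝ F]
  {G : Type*} [Group G] [TopologicalSpace G] [ChartedSpace E G] [LieGroup 𝓘(ℝ, E) ∞ G]
  {M : Type*} [TopologicalSpace M] [ChartedSpace F M] [IsManifold 𝓘(ℝ, F) ∞ M]
  [MulAction G M] [ContMDiffSMul 𝓘(ℝ, E) 𝓘(ℝ, F) ∞ G M]

/-- The fixed points of `k ↦ q k g⁻¹` are the `k` with `q k = k g`, and this map is periodic when `q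
^ n = g ^ n = 1`. -/
lemma iterate_mul_mul_inv {G : Type*} [Group G] (q g k : G) (n : ℕ) :
    (fun k => q * k * g⁻¹)^[n] k = q ^ n * k * (g ^ n)⁻¹ := by
  induction n with
  | zero => simp
  | succ n ih =>
    rw [Function.iterate_succ_apply', ih, pow_succ' q, pow_succ g, mul_inv_rev,
      ← inv_pow, (Commute.refl g⁻¹).pow_left n |>.eq.symm]
    simp only [mul_assoc]

lemma exists_pow_eq_one_of_smul_eq {G M : Type*} [Group G] [MulAction G M] {g : G} {x : M}
    (hx : Finite (MulAction.stabilizer G x)) (h : g • x = x) : ∃ n, 0 < n ∧ g ^ n = 1 := by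
  obtain ⟨n, hn, h1⟩ := isOfFinOrder_iff_pow_eq_one.mp
    (isOfFinOrder_of_finite (⟨g, h⟩ : MulAction.stabilizer G x))
  exact ⟨n, hn, congrArg Subtype.val h1⟩

omit [FiniteDimensional ℝ E] in
lemma contMDiff_mul_mul_inv (g : G) : ContMDiff (𝓘(ℝ, E).prod 𝓘(ℝ, E)) 𝓘(ℝ, E) ∞
    (fun z : G × G => z.1 * z.2 * g⁻¹) :=
  (contMDiff_fst.mul contMDiff_snd).mul contMDiff_const

/-- Elements of finite order can be conjugated smoothly to nearby elements of the same order. -/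
lemma exists_conjugator (g : G) {n : ℕ} (hn : 0 < n) (hg : g ^ n = 1) :
    ∃ (U : Set G) (σ : G → G), IsOpen U ∧ g ∈ U ∧ ContMDiffOn 𝓘(ℝ, E) 𝓘(ℝ, E) ∞ σ U ∧
      σ g = 1 ∧ ∀ q ∈ U, q ^ n = 1 → q * σ q = σ q * g := by
  have : CompleteSpace E := FiniteDimensional.complete ℝ E
  have hT : ∀ q : G, q ^ n = 1 → (fun k => q * k * g⁻¹)^[n] = id := fun q hq =>
    funext fun k => by rw [iterate_mul_mul_inv, hq, hg]; simp
  -- The conjugator is the retraction of `1` onto the fixed points of `k ↦ q k g⁻¹`; for `q = g` the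
  -- point `1` is already fixed.
  obtain ⟨U, τ, hU, h1U, hτ, hτU⟩ := exists_local_retraction_fixedPoints
    (T := fun q k => q * k * g⁻¹) (contMDiff_mul_mul_inv (E := E) g) (q₀ := g) (p := 1) (by simp)
    hn (hT g hg)
  refine ⟨{q | (q, 1) ∈ U}, fun q => τ (q, 1), hU.preimage (by fun_prop), h1U,
    hτ.comp (contMDiff_id.prodMk contMDiff_const).contMDiffOn fun q hq => hq,
    (hτU _ h1U (hT g hg)).2 (by simp), fun q hq hqn => ?_⟩
  exact mul_inv_eq_iff_eq_mul.mp (hτU _ hq (hT q hqn)).1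

/-- Near a loop, all loops have the same order. -/
lemma exists_pow_eq_one_of_loop (E : Type*) [NormedAddCommGroup E] [NormedSpace ℝ E] [FiniteDimensional ℝ E]
    (F : Type*) [NormedAddCommGroup F] [NormedSpace ℝ F] [FiniteDimensional ℝ F]
    {G : Type*} [Group G] [TopologicalSpace G] [ChartedSpace E G] [LieGroup 𝓘(ℝ, E) ∞ G]
    {M : Type*} [TopologicalSpace M] [ChartedSpace F M] [IsManifold 𝓘(ℝ, F) ∞ M]
    [MulAction G M] [ContMDiffSMul 𝓘(ℝ, E) 𝓘(ℝ, F) ∞ G M]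
    [T2Space G] {g : G} {x : M}
    (hx : Finite (MulAction.stabilizer G x)) (h : g • x = x) :
    ∃ n, 0 < n ∧ g ^ n = 1 ∧ ∃ U : Set (G × M), IsOpen U ∧ (g, x) ∈ U ∧
      ∀ z ∈ U, z.1 • z.2 = z.2 → z.1 ^ n = 1 := by
  have : IsTopologicalGroup G := topologicalGroup_of_lieGroup 𝓘(ℝ, E) ∞
  obtain ⟨n, hn, hg⟩ := exists_pow_eq_one_of_smul_eq hx h
  obtain ⟨U, hU, h1U, hfree⟩ := exists_locally_free E F x hx
  -- If `h` fixes `y`, so does `h ^ n`; near `g` it is close to `g ^ n = 1`, so local freeness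
  -- applies.
  refine ⟨n, hn, hg, {z | (z.1 ^ n, z.2) ∈ U}, hU.preimage (by fun_prop), ?_, fun z hz hz' => ?_⟩
  · simpa only [mem_ofPred_eq, hg] using h1U
  · refine hfree _ _ hz ?_
    exact (MulAction.stabilizer G z.2).pow_mem hz' n

lemma isSmoothManifold_fixedBy (E : Type*) [NormedAddCommGroup E] [NormedSpace ℝ E] [FiniteDimensional ℝ E]
    {F : Type*} [NormedAddCommGroup F] [NormedSpace ℝ F] [FiniteDimensional ℝ F]
    {G : Type*} [Group G] [TopologicalSpace G] [ChartedSpace E G] [LieGroup 𝓘(ℝ, E) ∞ G]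
    {M : Type*} [TopologicalSpace M] [ChartedSpace F M] [IsManifold 𝓘(ℝ, F) ∞ M]
    [MulAction G M] [ContMDiffSMul 𝓘(ℝ, E) 𝓘(ℝ, F) ∞ G M]
    [T2Space M] [ParacompactSpace M] (g : G) {n : ℕ} (hn : 0 < n)
    (hg : g ^ n = 1) :
    letI := manifoldDiffeology F M
    IsSmoothManifold (MulAction.fixedBy M g) := by
  let := manifoldDiffeology F M
  have : CompleteSpace E := FiniteDimensional.complete ℝ E
  have : CompleteSpace F := FiniteDimensional.complete ℝ F
  have hT : (fun x : M => g • x)^[n] = id := by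
    rw [smul_iterate, hg]
    exact funext (one_smul G)
  refine (isSmoothManifold_manifoldDiffeology (E := F) (X := M)).subtype
    (isClosed_eq (contMDiff_smul_left (F := F) E g).continuous continuous_id) fun x hx => ?_
  obtain ⟨U, τ, hU, h1U, hτ, hτU⟩ := exists_local_retraction_fixedPoints
    (T := fun (q : G) (x : M) => q • x)
    (ContMDiffSMul.contMDiff_smul (I := 𝓘(ℝ, E)) (I' := 𝓘(ℝ, F))) hx hn hT
  refine ⟨{y | (g, y) ∈ U}, fun y => τ (g, y), hU.preimage (by fun_prop), h1U, ?_,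
    fun y hy => (hτU _ hy hT).1, fun y hy => (hτU _ hy hT).2⟩
  exact (hτ.comp (contMDiff_const.prodMk contMDiff_id).contMDiffOn fun y hy => hy).dSmoothOn

/-- The centraliser is the fixed point set of conjugation by `g`, which is periodic because `g` has
finite order. -/
lemma isSmoothManifold_centralizer [T2Space G] [ParacompactSpace G] (g : G) {n : ℕ} (hn : 0 < n)
    (hg : g ^ n = 1) :
    letI := manifoldDiffeology E G
    IsSmoothManifold (Subgroup.centralizer ({g} : Set G)) := by
  let := manifoldDiffeology E G
  have : CompleteSpace E := FiniteDimensional.complete ℝ E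
  have : IsTopologicalGroup G := topologicalGroup_of_lieGroup 𝓘(ℝ, E) ∞
  have hT : (fun k : G => g * k * g⁻¹)^[n] = id :=
    funext fun k => by rw [iterate_mul_mul_inv, hg]; simp
  have hmem : ∀ k : G, k ∈ Subgroup.centralizer ({g} : Set G) ↔ g * k * g⁻¹ = k := fun k => by
    rw [Subgroup.mem_centralizer_singleton_iff, mul_inv_eq_iff_eq_mul]
    exact eq_comm
  refine (isSmoothManifold_manifoldDiffeology (E := E) (X := G)).subtype
    (A := fun k => k ∈ Subgroup.centralizer ({g} : Set G)) ?_ fun k hk => ?_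
  · simp only [hmem]
    exact isClosed_eq (by fun_prop) continuous_id
  obtain ⟨U, τ, hU, h1U, hτ, hτU⟩ := exists_local_retraction_fixedPoints
    (T := fun q k => q * k * g⁻¹) (contMDiff_mul_mul_inv (E := E) g) ((hmem k).mp hk) hn hT
  refine ⟨{y | (g, y) ∈ U}, fun y => τ (g, y), hU.preimage (by fun_prop), h1U, ?_,
    fun y hy => (hmem _).mpr (hτU _ hy hT).1, fun y hy h => (hτU _ hy hT).2 ((hmem _).mp h)⟩
  exact (hτ.comp (contMDiff_const.prodMk contMDiff_id).contMDiffOn fun y hy => hy).dSmoothOn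

lemma isSmoothManifold_loops [CompactSpace G] [T2Space G] [T2Space M] [ParacompactSpace M]
    (almostFree : ∀ x : M, Finite (MulAction.stabilizer G x)) :
    letI := manifoldDiffeology E G
    letI := manifoldDiffeology F M
    IsSmoothManifold {z : G × M // z.2 = z.1 • z.2} := by
  let := manifoldDiffeology E G
  let := manifoldDiffeology F M
  have : CompleteSpace E := FiniteDimensional.complete ℝ E
  have : CompleteSpace F := FiniteDimensional.complete ℝ F
  have hsmul := ContMDiffSMul.contMDiff_smul (I := 𝓘(ℝ, E)) (I' := 𝓘(ℝ, F)) (n := ∞)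
    (G := G) (M := M)
  refine ((isSmoothManifold_manifoldDiffeology (E := E) (X := G)).prod
    (isSmoothManifold_manifoldDiffeology (E := F) (X := M)) inferInstance).subtype
    (isClosed_eq continuous_snd hsmul.continuous) ?_
  rintro ⟨g, x⟩ hx
  obtain ⟨n, hn, hg, U₁, hU₁, h₁, hpow⟩ :=
    exists_pow_eq_one_of_loop E F (almostFree x) (Eq.symm hx)
  obtain ⟨U₂, σ, hU₂, h₂, hσ, hσg, hconj⟩ := exists_conjugator (E := E) g hn hg
  have hT : ∀ q : G, q ^ n = 1 → (fun x : M => q • x)^[n] = id := fun q hq => by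
    rw [smul_iterate, hq]
    exact funext (one_smul G)
  obtain ⟨U₃, τ, hU₃, h₃, hτ, hτU⟩ := exists_local_retraction_fixedPoints
    (T := fun (q : G) (x : M) => q • x) hsmul (Eq.symm hx) hn (hT g hg)
  -- Near `g`, an element `q` need not satisfy `q ^ n = 1`, but its replacement `c = σ(q) g σ(q)⁻¹`
  -- always does, and `c = q` when `(q, y)` is a loop. Then `τ (c, y)` is fixed by `c`, so `(q, y) ↦
  -- (c, τ (c, y))` retracts onto the loops.
  set c : G × M → G := fun z => σ z.1 * g * (σ z.1)⁻¹
  have hc : ContMDiffOn (𝓘(ℝ, E).prod 𝓘(ℝ, F)) 𝓘(ℝ, E) ∞ c (Prod.fst ⁻¹' U₂) := by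
    have h := hσ.comp (contMDiffOn_fst (I := 𝓘(ℝ, E)) (J := 𝓘(ℝ, F)) (N := M)
      (s := Prod.fst ⁻¹' U₂)) fun z hz => hz
    exact (h.mul contMDiffOn_const).mul h.inv
  have hcn : ∀ z, c z ^ n = 1 := fun z => by
    simp only [c, conj_pow, hg, mul_one, mul_inv_cancel]
  have hcz : ∀ z ∈ U₁ ∩ Prod.fst ⁻¹' U₂, z.2 = z.1 • z.2 → c z = z.1 := fun z hz h =>
    mul_inv_eq_iff_eq_mul.mpr (hconj _ hz.2 (hpow z hz.1 h.symm)).symm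
  have hO : IsOpen (U₁ ∩ Prod.fst ⁻¹' U₂) := hU₁.inter (hU₂.preimage continuous_fst)
  have hcs : ContMDiffOn (𝓘(ℝ, E).prod 𝓘(ℝ, F)) (𝓘(ℝ, E).prod 𝓘(ℝ, F)) ∞ (fun z => (c z, z.2))
      (U₁ ∩ Prod.fst ⁻¹' U₂) := (hc.mono inter_subset_right).prodMk contMDiffOn_snd
  refine ⟨(U₁ ∩ Prod.fst ⁻¹' U₂) ∩ (fun z => (c z, z.2)) ⁻¹' U₃,
    fun z => (c z, τ (c z, z.2)), hcs.continuousOn.isOpen_inter_preimage hO hU₃,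
    ⟨⟨h₁, h₂⟩, ?_⟩, ?_, ?_, ?_⟩
  · simpa [c, hσg] using h₃
  · intro m p hp hpU
    exact ⟨hc.dSmoothOn_prod m p hp fun y => (hpU y).1.2,
      ((hτ.comp (hcs.mono inter_subset_left) fun z hz => hz.2).dSmoothOn_prod) m p hp hpU⟩
  · intro z hz
    exact (hτU _ hz.2 (hT _ (hcn z))).1.symm
  · intro z hz h
    have h4 := hcz z hz.1 h
    refine Prod.ext h4 ((hτU _ hz.2 (hT _ (hcn z))).2 ?_)
    simp only [h4]
    exact h.symm

lemma exists_loop_conjugator [T2Space G]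
    (almostFree : ∀ x : M, Finite (MulAction.stabilizer G x)) :
    letI := manifoldDiffeology E G
    letI := manifoldDiffeology F M
    ∀ a : {z : G × M // z.2 = z.1 • z.2}, ∃ (U : Set {z : G × M // z.2 = z.1 • z.2})
      (σ : {z : G × M // z.2 = z.1 • z.2} → G), IsOpen U ∧ a ∈ U ∧
      DSmoothOn σ U ∧ σ a = 1 ∧ ∀ b ∈ U, b.1.1 * σ b = σ b * a.1.1 := by
  let := manifoldDiffeology E G
  let := manifoldDiffeology F M
  rintro ⟨⟨g, x⟩, hx⟩
  obtain ⟨n, hn, hg, U₁, hU₁, h₁, hpow⟩ :=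
    exists_pow_eq_one_of_loop E F (almostFree x) (Eq.symm hx)
  obtain ⟨U₂, σ, hU₂, h₂, hσ, hσg, hconj⟩ := exists_conjugator (E := E) g hn hg
  refine ⟨{b | b.1 ∈ U₁ ∧ b.1.1 ∈ U₂}, fun b => σ b.1.1,
    (hU₁.preimage (by fun_prop)).inter (hU₂.preimage (by fun_prop)), ⟨h₁, h₂⟩, ?_, hσg,
    fun b hb => hconj _ hb.2 (hpow _ hb.1 b.2.symm)⟩
  exact fun m p hp hpU => hσ.dSmoothOn m (fun y => (p y).1.1) hp.1 fun y => (hpU y).2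

end Loops

/-! ### Lie groupoids -/

lemma Diffeology.DSmooth.sigma {ι : Type*} {X : ι → Type*} [∀ i, DiffeologicalSpace (X i)]
    {Y : Type*} [DiffeologicalSpace Y] {f : (Σ i, X i) → Y}
    (hf : ∀ i, DSmooth fun x => f ⟨i, x⟩) : DSmooth f := by
  rintro n _ ⟨i, q, hq, rfl⟩
  exact hf i n q hq

lemma Diffeology.DSmooth.sigmaMap {ι : Type*} {X Y : ι → Type*} [∀ i, DiffeologicalSpace (X i)]
    [∀ i, DiffeologicalSpace (Y i)] {f : ∀ i, X i → Y i} (hf : ∀ i, DSmooth (f i)) :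
    DSmooth fun x : Σ i, X i => (⟨x.1, f x.1 x.2⟩ : Σ i, Y i) :=
  DSmooth.sigma fun i n q hq => ⟨i, _, hf i n q hq, rfl⟩

namespace DiffGroupoid

lemma isLie_ofAction {G X : Type*} [Group G] [TopologicalSpace G] [DiffeologicalSpace G]
    [TopologicalSpace X] [DiffeologicalSpace X] [MulAction G X]
    (hX : IsSmoothManifold X) (hGX : IsSmoothManifold (G × X))
    (hmul : DSmooth fun z : G × G => z.1 * z.2) (hinv : DSmooth fun g : G => g⁻¹)
    (hsmul : DSmooth fun z : G × X => z.1 • z.2) : (ofAction G X).IsLie where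
  manifold_obj := hX
  manifold_arr := hGX
  submersion_src := .of_local_sections hGX hX (fun _ _ hp => hp.2) fun a =>
    ⟨univ, fun x => (a.1, x), Filter.univ_mem, fun _ _ hp _ => ⟨isPlot_const, hp⟩, rfl,
      fun _ _ => rfl⟩
  smooth_tgt := hsmul
  smooth_unit := fun _ _ hp => ⟨isPlot_const, hp⟩
  smooth_inv := fun n p hp => ⟨hinv n _ hp.1, hsmul n p hp⟩
  smooth_comp := fun n p hp => ⟨hmul n (fun y => ((p y).1.1.1, (p y).1.2.1)) ⟨hp.1.1, hp.2.1⟩,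
    hp.2.2⟩

/-- An arrow of the inertia groupoid is determined by its group element and its source loop, so the
arrows form `G × S`. Compactness of `G` makes this product paracompact. -/
lemma isLie_inertia_ofAction {G X : Type*} [Group G] [TopologicalSpace G] [DiffeologicalSpace G]
    [CompactSpace G] [TopologicalSpace X] [DiffeologicalSpace X] [MulAction G X]
    (hG : IsSmoothManifold G) (hL : IsSmoothManifold (ofAction G X).Loops)
    (hmul : DSmooth fun z : G × G => z.1 * z.2) (hinv : DSmooth fun g : G => g⁻¹)
    (hsmul : DSmooth fun z : G × X => z.1 • z.2) : (ofAction G X).inertia.IsLie := by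
  have := hL.paracompact
  have hA : IsSmoothManifold (ofAction G X).inertia.Arr := by
    refine IsDiffeo.isSmoothManifold (X := G × (ofAction G X).Loops)
      (f := fun z => ⟨((z.1, z.2.1.2), z.2), rfl⟩) ?_ (hG.prod hL inferInstance)
    refine ⟨⟨⟨fun z => ⟨((z.1, z.2.1.2), z.2), rfl⟩, fun a => (a.1.1.1, a.1.2), fun _ => rfl,
      fun a => Subtype.ext (Prod.ext (Prod.ext rfl a.2.symm) rfl)⟩, ?_, ?_⟩, rfl, ?_, ?_⟩
    · exact Continuous.subtype_mk (by fun_prop) _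
    · exact Continuous.prodMk (by fun_prop) (by fun_prop)
    · exact fun _ _ hp => ⟨⟨hp.1, hp.2.2⟩, hp.2⟩
    · exact fun _ _ hp => ⟨hp.1.1, hp.2⟩
  have htgt : DSmooth (ofAction G X).inertia.tgt := fun n p hp =>
    ⟨hmul n (fun y => ((p y).1.1.1 * (p y).1.2.1.1, (p y).1.1.1⁻¹))
      ⟨hmul n (fun y => ((p y).1.1.1, (p y).1.2.1.1)) ⟨hp.1.1, hp.2.1⟩, hinv n _ hp.1.1⟩,
      hsmul n (fun y => (p y).1.1) hp.1⟩
  exact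
    { manifold_obj := hL
      manifold_arr := hA
      submersion_src := .of_local_sections hA hL (fun _ _ hp => hp.2) fun a =>
        ⟨univ, fun δ => ⟨((a.1.1.1, δ.1.2), δ), rfl⟩, Filter.univ_mem,
          fun _ _ hp _ => ⟨⟨isPlot_const, hp.2⟩, hp⟩,
          Subtype.ext (Prod.ext (Prod.ext rfl a.2.symm) rfl), fun _ _ => rfl⟩
      smooth_tgt := htgt
      smooth_unit := fun _ _ hp => ⟨⟨isPlot_const, hp.2⟩, hp⟩
      smooth_inv := fun n p hp => ⟨⟨hinv n _ hp.1.1, hsmul n (fun y => (p y).1.1) hp.1⟩,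
        htgt n p hp⟩
      smooth_comp := fun n p hp =>
        ⟨⟨hmul n (fun y => ((p y).1.1.1.1.1, (p y).1.2.1.1.1)) ⟨hp.1.1.1, hp.2.1.1⟩, hp.2.1.2⟩,
          hp.2.2⟩ }

/-- The hypothesis `hsec` allows submersivity of the source to be checked through sections, without
comparing charts of the disjoint union with charts of its summands. -/
lemma isLie_disjointUnion {ι : Type*} {𝒢 : ι → DiffGroupoid} (h : ∀ i, (𝒢 i).IsLie)
    (hsec : ∀ i (a : (𝒢 i).Arr), ∃ s : (𝒢 i).Obj → (𝒢 i).Arr, DSmooth s ∧ s ((𝒢 i).src a) = a ∧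
      ∀ x, (𝒢 i).src (s x) = x) :
    (disjointUnion 𝒢).IsLie where
  manifold_obj := .sigma fun i => (h i).manifold_obj
  manifold_arr := .sigma fun i => (h i).manifold_arr
  submersion_src := by
    refine .of_local_sections (.sigma fun i => (h i).manifold_arr)
      (.sigma fun i => (h i).manifold_obj) (.sigmaMap fun i => (h i).submersion_src.smooth) ?_
    rintro ⟨i, a⟩
    obtain ⟨s, hs, hsa, hsx⟩ := hsec i a
    classical
    -- Only the summand `i` matters; the units extend the section to the other summands.
    let σ : ∀ j, (𝒢 j).Obj → (𝒢 j).Arr := Function.update (fun j => (𝒢 j).unit) i s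
    have hσi : σ i = s := Function.update_self ..
    have hσ : ∀ j, DSmooth (σ j) ∧ ∀ x, (𝒢 j).src (σ j x) = x := by
      intro j
      by_cases hj : j = i
      · subst hj
        rw [hσi]
        exact ⟨hs, hsx⟩
      · have : σ j = (𝒢 j).unit := Function.update_of_ne hj ..
        rw [this]
        exact ⟨(h j).smooth_unit, (𝒢 j).src_unit⟩
    refine ⟨univ, fun x => ⟨x.1, σ x.1 x.2⟩, Filter.univ_mem,
      (DSmooth.sigmaMap fun j => (hσ j).1).dSmoothOn _, ?_, ?_⟩
    · simp only [hσi, hsa]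
    · rintro ⟨j, x⟩ -
      simp only [(hσ j).2]
  smooth_tgt := .sigmaMap fun i => (h i).smooth_tgt
  smooth_unit := .sigmaMap fun i => (h i).smooth_unit
  smooth_inv := .sigmaMap fun i => (h i).smooth_inv
  smooth_comp := by
    rintro n p ⟨⟨i, b, hb, hpb⟩, ⟨j, a, ha, hpa⟩⟩
    have hab : ∀ y, (disjointUnion 𝒢).src ⟨i, b y⟩ = (disjointUnion 𝒢).tgt ⟨j, a y⟩ := fun y =>
      (congrArg _ (congrFun hpb y)).symm.trans ((p y).2.trans (congrArg _ (congrFun hpa y)))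
    obtain rfl : i = j := congrArg Sigma.fst (hab 0)
    have hab' : ∀ y, (𝒢 i).src (b y) = (𝒢 i).tgt (a y) := fun y =>
      eq_of_heq (Sigma.mk.inj (hab y)).2
    obtain rfl : p = fun y => ⟨(⟨i, b y⟩, ⟨i, a y⟩), hab y⟩ :=
      funext fun y => Subtype.ext (Prod.ext (congrFun hpb y) (congrFun hpa y))
    exact ⟨i, fun y => (𝒢 i).comp (b y) (a y) (hab' y),
      (h i).smooth_comp n (fun y => ⟨(b y, a y), hab' y⟩) ⟨hb, ha⟩, rfl⟩

lemma continuous_toOrbit (𝒢 : DiffGroupoid) : Continuous 𝒢.toOrbit := continuous_quot_mk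

/-! ### The comparison functor and its effect on orbit spaces -/

section FixedPoints

variable {G M : Type*} [Group G] [TopologicalSpace G] [DiffeologicalSpace G]
  [TopologicalSpace M] [DiffeologicalSpace M] [MulAction G M] (R : Set G)

/-- The disjoint union of the groupoids `Z(g) ⋉ M^g` for `g ∈ R`. -/
@[reducible]
def fixedPointUnion (G M : Type*) [Group G] [TopologicalSpace G] [DiffeologicalSpace G]
    [TopologicalSpace M] [DiffeologicalSpace M] [MulAction G M] (R : Set G) : DiffGroupoid :=
  disjointUnion fun g : R => fixedPointGroupoid G M g

lemma isLie_fixedPointGroupoid (g : G) (hM : IsSmoothManifold (MulAction.fixedBy M g))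
    (hZM : IsSmoothManifold (Subgroup.centralizer ({g} : Set G) × MulAction.fixedBy M g))
    (hmul : DSmooth fun z : G × G => z.1 * z.2) (hinv : DSmooth fun g : G => g⁻¹)
    (hsmul : DSmooth fun z : G × M => z.1 • z.2) : (fixedPointGroupoid G M g).IsLie :=
  isLie_ofAction hM hZM
    (fun n p hp => hmul n (fun y => ((p y).1.1, (p y).2.1)) hp)
    (fun n p hp => hinv n (fun y => (p y).1) hp)
    (fun n p hp => hsmul n (fun y => ((p y).1.1, (p y).2.1)) hp)

lemma isLie_fixedPointUnion (h : ∀ g ∈ R, (fixedPointGroupoid G M g).IsLie) :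
    (fixedPointUnion G M R).IsLie :=
  isLie_disjointUnion (fun g => h g g.2) fun _ a =>
    ⟨fun x => (a.1, x), fun _ _ hp => ⟨isPlot_const, hp⟩, rfl, fun _ => rfl⟩

/-- The homomorphism from the disjoint union of the groupoids `Z(g) ⋉ M^g` to the inertia groupoid
sending `x ∈ M^g` to the loop `g` at `x`. -/
def fixedPointHom : Hom (fixedPointUnion G M R) (ofAction G M).inertia where
  obj x := ⟨(x.1, x.2.1), x.2.2.symm⟩
  arr a := ⟨((a.2.1.1, a.2.2.1), ⟨(a.1, a.2.2.1), a.2.2.2.symm⟩), rfl⟩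
  smooth_obj := .sigma fun r _ _ hp => ⟨isPlot_const (x := (r : G)), hp⟩
  smooth_arr := .sigma fun r _ _ hp => ⟨⟨hp.1, hp.2⟩, isPlot_const (x := (r : G)), hp.2⟩
  src_arr _ := rfl
  tgt_arr a := by
    refine Subtype.ext (Prod.ext ?_ rfl)
    exact mul_inv_eq_iff_eq_mul.mpr (Subgroup.mem_centralizer_singleton_iff.mp a.2.1.2)
  arr_unit _ := rfl
  arr_comp := by
    rintro ⟨r, b⟩ ⟨r', a⟩ h
    obtain rfl : r = r' := congrArg Sigma.fst h
    rfl

/-- The target of the arrow `k` starting at the loop `g` at `x ∈ M^g`. -/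
def conjLoop (z : Σ g : R, MulAction.fixedBy M (g : G) × G) : (ofAction G M).Loops :=
  ⟨(z.2.2 * z.1 * z.2.2⁻¹, z.2.2 • z.2.1.1), by
    have h : (z.1 : G) • (z.2.1.1 : M) = z.2.1.1 := z.2.1.2
    change z.2.2 • z.2.1.1 = (z.2.2 * z.1 * z.2.2⁻¹) • z.2.2 • z.2.1.1
    rw [smul_smul, inv_mul_cancel_right, mul_smul, h]⟩

lemma surjective_conjLoop (hR : ∀ g : G, ∃! r : G, r ∈ R ∧ IsConj r g) :
    Function.Surjective (conjLoop (M := M) R) := by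
  rintro ⟨⟨g, x⟩, hx⟩
  obtain ⟨r, ⟨hr, hrg⟩, -⟩ := hR g
  obtain ⟨k, rfl⟩ := isConj_iff.mp hrg
  have hx : x = (k * r * k⁻¹) • x := hx
  refine ⟨⟨⟨r, hr⟩, ⟨k⁻¹ • x, ?_⟩, k⟩, Subtype.ext (Prod.ext rfl (smul_inv_smul k x))⟩
  rw [MulAction.mem_fixedBy]
  nth_rewrite 2 [hx]
  simp only [smul_smul, mul_assoc, inv_mul_cancel_left]

/-- The condition that nearby loops are smoothly conjugate to a given one. -/
def HasLocalConjugators (G M : Type*) [Group G] [TopologicalSpace G] [DiffeologicalSpace G]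
    [TopologicalSpace M] [DiffeologicalSpace M] [MulAction G M] : Prop :=
  ∀ a : (ofAction G M).Loops, ∃ (U : Set (ofAction G M).Loops) (σ : (ofAction G M).Loops → G),
    IsOpen U ∧ a ∈ U ∧ DSmoothOn σ U ∧ σ a = 1 ∧ ∀ b ∈ U, b.1.1 * σ b = σ b * a.1.1

/-- Near the loop `k r k⁻¹` at `k x`, a loop `b = (h, y)` satisfies `h = (σ(b) k) r (σ(b) k)⁻¹`.
Thus `(σ(b) k)⁻¹ y` is fixed by `r`, and it is carried to `b` by `σ(b) k`. -/
lemma exists_local_section_conjLoop (hmul : DSmooth fun z : G × G => z.1 * z.2)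
    (hinv : DSmooth fun g : G => g⁻¹) (hsmul : DSmooth fun z : G × M => z.1 • z.2)
    (hσ : HasLocalConjugators G M) (z : Σ g : R, MulAction.fixedBy M (g : G) × G) :
    ∃ (V : Set (ofAction G M).Loops)
      (s : (ofAction G M).Loops → Σ g : R, MulAction.fixedBy M (g : G) × G),
      V ∈ 𝓝 (conjLoop R z) ∧ DSmoothOn s V ∧ s (conjLoop R z) = z ∧
      ∀ b ∈ V, conjLoop R (s b) = b := by
  obtain ⟨U, σ, hU, hzU, hσs, hσz, hconj⟩ := hσ (conjLoop R z)
  obtain ⟨r, x, k⟩ := z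
  have hconj' : ∀ b ∈ U, b.1.1 * (σ b * k) = σ b * k * r := fun b hb => by
    rw [← mul_assoc, hconj b hb]
    simp only [conjLoop, mul_assoc, inv_mul_cancel, mul_one]
  have hfix : ∀ b : (ofAction G M).Loops, b.1.1 * (σ b * k) = σ b * k * r →
      (σ b * k)⁻¹ • b.1.2 ∈ MulAction.fixedBy M (r : G) := fun b hb => by
    have h1 : b.1.1 • b.1.2 = b.1.2 := b.2.symm
    rw [MulAction.mem_fixedBy, smul_smul, eq_inv_smul_iff, smul_smul, ← mul_assoc, ← hb,
      mul_inv_cancel_right, h1]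
  classical
  -- The second branch is a default value, never taken on `U`.
  let s : (ofAction G M).Loops → Σ g : R, MulAction.fixedBy M (g : G) × G := fun b =>
    if h : b.1.1 * (σ b * k) = σ b * k * r then ⟨r, ⟨(σ b * k)⁻¹ • b.1.2, hfix b h⟩, σ b * k⟩
    else ⟨r, x, k⟩
  have hs : ∀ b (hb : b ∈ U), s b = ⟨r, ⟨(σ b * k)⁻¹ • b.1.2, hfix b (hconj' b hb)⟩, σ b * k⟩ :=
    fun b hb => dif_pos (hconj' b hb)
  refine ⟨U, s, hU.mem_nhds hzU, ?_, ?_, ?_⟩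
  · intro n p hp hpU
    have h1 : IsPlot (fun y => σ (p y) * k) :=
      hmul n (fun y => (σ (p y), k)) ⟨hσs n p hp hpU, isPlot_const⟩
    refine ⟨r, fun y => (⟨(σ (p y) * k)⁻¹ • (p y).1.2, hfix _ (hconj' _ (hpU y))⟩, σ (p y) * k),
      ⟨hsmul n (fun y => ((σ (p y) * k)⁻¹, (p y).1.2)) ⟨hinv n _ h1, hp.2⟩, h1⟩,
      funext fun y => hs _ (hpU y)⟩
  · rw [hs _ hzU]
    simp only [hσz, one_mul]
    refine Sigma.ext rfl (heq_of_eq (Prod.ext (Subtype.ext ?_) rfl))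
    exact inv_smul_smul k _
  · intro b hb
    rw [hs b hb]
    refine Subtype.ext (Prod.ext ?_ ?_)
    · exact mul_inv_eq_iff_eq_mul.mpr (hconj' b hb).symm
    · exact smul_inv_smul _ _

omit [TopologicalSpace G] [DiffeologicalSpace G] in
lemma eq_of_eq_conj {R : Set G} (hR : ∀ g : G, ∃! r : G, r ∈ R ∧ IsConj r g) {r r' : R} {k : G}
    (h : (r' : G) = k * r * k⁻¹) : r = r' :=
  Subtype.ext ((hR r').unique ⟨r.2, isConj_iff.mpr ⟨k, h.symm⟩⟩ ⟨r'.2, IsConj.refl _⟩)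

omit [DiffeologicalSpace G] [DiffeologicalSpace M] in
-- Continuity into the arrows of the disjoint union can thereby be tested on the source object and
-- the group element, although the centraliser varies with the index.
lemma isInducing_sigma_centralizer :
    IsInducing fun a : Σ g : R, Subgroup.centralizer ({(g : G)} : Set G) ×
      MulAction.fixedBy M (g : G) =>
      (((⟨a.1, a.2.2⟩ : Σ g : R, MulAction.fixedBy M (g : G)), (a.2.1 : G)) :
        (Σ g : R, MulAction.fixedBy M (g : G)) × G) := by
  have h1 : IsInducing (Sigma.map (β₂ := fun g : R => MulAction.fixedBy M (g : G) × G) id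
      fun (g : R) (a : Subgroup.centralizer ({(g : G)} : Set G) ×
      MulAction.fixedBy M (g : G)) => (a.2, (a.1 : G))) := by
    rw [isInducing_sigmaMap Function.injective_id]
    intro g
    exact (IsInducing.id.prodMap IsInducing.subtypeVal).comp (Homeomorph.prodComm _ _).isInducing
  exact Homeomorph.sigmaProdDistrib.symm.isInducing.comp h1

lemma isWeakEquivalence_fixedPointHom [CompactSpace G] [ContinuousSMul G M] (hG : IsSmoothManifold G)
    (hM : ∀ g : G, IsSmoothManifold (MulAction.fixedBy M g))
    (hL : IsSmoothManifold (ofAction G M).Loops)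
    (hmul : DSmooth fun z : G × G => z.1 * z.2)
    (hinv : DSmooth fun g : G => g⁻¹) (hsmul : DSmooth fun z : G × M => z.1 • z.2)
    (hσ : HasLocalConjugators G M) (hR : ∀ g : G, ∃! r : G, r ∈ R ∧ IsConj r g) :
    (fixedPointHom (M := M) R).IsWeakEquivalence := by
  have := fun g => (hM g).paracompact
  have hN : IsSmoothManifold (Σ g : R, MulAction.fixedBy M (g : G) × G) :=
    .sigma fun g => (hM g).prod hG inferInstance
  -- The pullback in condition (i) is diffeomorphic to `⊔ M^g × G`, and `t ∘ pr₂` becomes `conjLoop`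
  -- there.
  let P := {p : (fixedPointUnion G M R).Obj × (ofAction G M).inertia.Arr //
    (fixedPointHom R).obj p.1 = (ofAction G M).inertia.src p.2}
  let ε : (Σ g : R, MulAction.fixedBy M (g : G) × G) → P :=
    fun z => ⟨(⟨z.1, z.2.1⟩, ⟨((z.2.2, z.2.1.1), ⟨(z.1, z.2.1.1), z.2.1.2.symm⟩), rfl⟩), rfl⟩
  let ε' : P → (Σ g : R, MulAction.fixedBy M (g : G) × G) :=
    fun p => ⟨p.1.1.1, p.1.1.2, p.1.2.1.1.1⟩
  have hεε' : ∀ p, ε (ε' p) = p := fun p =>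
    Subtype.ext (Prod.ext rfl (Subtype.ext (Prod.ext (Prod.ext rfl
      ((congrArg (fun a => a.1.2) p.2).trans p.1.2.2.symm)) p.2)))
  have hεs : DSmooth ε := .sigma fun g n p hp =>
    ⟨⟨g, _, hp.1, rfl⟩, ⟨hp.2, hp.1⟩, isPlot_const (x := (g : G)), hp.1⟩
  have hε : IsDiffeo ε := by
    refine ⟨⟨⟨ε, ε', fun _ => rfl, hεε'⟩, ?_, ?_⟩, rfl, hεs, ?_⟩
    · refine Continuous.subtype_mk (continuous_sigma fun g => ?_) _
      have hmk := continuous_sigmaMk (σ := fun g : R => MulAction.fixedBy M (g : G)) (i := g)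
      have hval : Continuous fun z : MulAction.fixedBy M (g : G) × G => (z.1 : M) :=
        continuous_subtype_val.comp continuous_fst
      exact (hmk.comp continuous_fst).prodMk (Continuous.subtype_mk
        ((continuous_snd.prodMk hval).prodMk
          (Continuous.subtype_mk ((continuous_const (y := (g : G))).prodMk hval) _)) _)
    · exact Homeomorph.sigmaProdDistrib.continuous.comp
        (f := fun p : P => (p.1.1, p.1.2.1.1.1)) (by fun_prop)
    · rintro n p ⟨⟨g, q, hq, hpq⟩, hp⟩
      refine ⟨g, fun y => (q y, (p y).1.2.1.1.1), ⟨hq, hp.1.1⟩, funext fun y => ?_⟩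
      exact congrArg (fun x : Σ g : R, MulAction.fixedBy M (g : G) =>
        (⟨x.1, x.2, (p y).1.2.1.1.1⟩ : Σ g : R, MulAction.fixedBy M (g : G) × G)) (congrFun hpq y)
  have htε : ∀ z, (ofAction G M).inertia.tgt (ε z).1.2 = conjLoop R z := fun z => rfl
  refine ⟨?_, ?_, ?_⟩
  · refine .of_local_sections (hε.isSmoothManifold hN) hL ?_ fun p => ?_
    · intro n p hp
      exact (isLie_inertia_ofAction hG hL hmul hinv hsmul).smooth_tgt n (fun y => (p y).1.2) hp.2
    · obtain ⟨V, s, hV, hs, hsz, hts⟩ :=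
        exists_local_section_conjLoop R hmul hinv hsmul hσ (ε' p)
      rw [← htε, hεε'] at hV hsz
      refine ⟨V, ε ∘ s, hV, (hεs.dSmoothOn univ).comp hs (mapsTo_univ _ _), ?_, hts⟩
      rw [Function.comp_apply, hsz, hεε']
  · intro a
    obtain ⟨z, hz⟩ := surjective_conjLoop R hR a
    exact ⟨ε z, hz⟩
  · set W := {p : ((fixedPointUnion G M R).Obj × (fixedPointUnion G M R).Obj) ×
      (ofAction G M).inertia.Arr // ((fixedPointHom R).obj p.1.1, (fixedPointHom R).obj p.1.2) =
        ((ofAction G M).inertia.src p.2, (ofAction G M).inertia.tgt p.2)}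
    -- An arrow `k` between loops over `r` and `r'` gives `r' = k r k⁻¹`; both lie in `R`, so `r =
    -- r'` and `k` centralises `r`. The inverse `β` keeps `k` and the source object.
    have hconj : ∀ p : W, (p.1.1.2.1 : G) = p.1.2.1.1.1 * p.1.1.1.1 * (p.1.2.1.1.1)⁻¹ := by
      intro p
      obtain ⟨h1, h2⟩ := Prod.mk.inj p.2
      have h3 : (p.1.1.1.1 : G) = p.1.2.1.2.1.1 := congrArg (fun a => a.1.1) h1
      rw [h3]
      exact congrArg (fun a => a.1.1) h2
    have hidx : ∀ p : W, p.1.1.1.1 = p.1.1.2.1 := fun p => eq_of_eq_conj hR (hconj p)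
    have hmem : ∀ p : W, p.1.2.1.1.1 ∈ Subgroup.centralizer ({(p.1.1.1.1 : G)} : Set G) := by
      intro p
      have h1 := hconj p
      rw [← hidx p, eq_comm, mul_inv_eq_iff_eq_mul] at h1
      exact Subgroup.mem_centralizer_singleton_iff.mpr h1
    let β : W → (fixedPointUnion G M R).Arr := fun p => ⟨p.1.1.1.1, ⟨_, hmem p⟩, p.1.1.1.2⟩
    refine ⟨⟨⟨_, β, fun _ => rfl, fun p => ?_⟩, ?_, ?_⟩, rfl, ?_, ?_⟩
    · obtain ⟨h1, h2⟩ := Prod.mk.inj p.2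
      have h3 := congrArg (fun a => a.1.2) h1
      have h4 := congrArg (fun a => a.1.2) h2
      have harr : (fixedPointHom R).arr (β p) = p.1.2 :=
        Subtype.ext (Prod.ext (Prod.ext rfl (h3.trans p.1.2.2.symm)) h1)
      refine Subtype.ext (Prod.ext (Prod.ext rfl ?_) harr)
      have h5 : ∀ x y : Σ g : R, MulAction.fixedBy M (g : G), x.1 = y.1 →
          (x.2 : M) = y.2 → x = y := by
        rintro ⟨i, x⟩ ⟨j, y⟩ hij hxy
        obtain rfl : i = j := hij
        exact congrArg _ (Subtype.ext hxy)
      refine h5 _ _ (hidx p) (Eq.trans ?_ h4.symm)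
      change p.1.2.1.1.1 • (p.1.1.1.2 : M) = p.1.2.1.1.1 • p.1.2.1.1.2
      exact congrArg _ (h3.trans p.1.2.2.symm)
    · refine Continuous.subtype_mk (continuous_sigma fun g => ?_) _
      have hmk := continuous_sigmaMk (σ := fun g : R => MulAction.fixedBy M (g : G)) (i := g)
      have htgt : Continuous (fixedPointGroupoid G M (g : G)).tgt :=
        Continuous.subtype_mk ((continuous_subtype_val.comp continuous_fst).smul
          (continuous_subtype_val.comp continuous_snd)) _
      have hval : Continuous fun a : Subgroup.centralizer ({(g : G)} : Set G) ×
          MulAction.fixedBy M (g : G) => (a.2 : M) := continuous_subtype_val.comp continuous_snd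
      have hval' : Continuous fun a : Subgroup.centralizer ({(g : G)} : Set G) ×
          MulAction.fixedBy M (g : G) => (a.1 : G) := continuous_subtype_val.comp continuous_fst
      exact Continuous.prodMk (Continuous.prodMk (hmk.comp continuous_snd) (hmk.comp htgt))
        (Continuous.subtype_mk ((hval'.prodMk hval).prodMk
          (Continuous.subtype_mk ((continuous_const (y := (g : G))).prodMk hval) _)) _)
    · refine (isInducing_sigma_centralizer R).continuous_iff.mpr ?_
      change Continuous fun p : W => (p.1.1.1, p.1.2.1.1.1)
      fun_prop
    · refine .sigma fun g n q hq => ⟨⟨⟨g, _, hq.2, rfl⟩, ⟨g, _, ?_, rfl⟩⟩,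
        (fixedPointHom R).smooth_arr n _ ⟨g, q, hq, rfl⟩⟩
      exact hsmul n (fun y => ((q y).1.1, (q y).2.1)) hq
    -- A plot of source objects stays in one summand `g`, so all the group elements lie in the same
    -- centraliser.
    · rintro n p ⟨⟨⟨g, q, hq, hpq⟩, -⟩, hk⟩
      have hm : ∀ y, (p y).1.2.1.1.1 ∈ Subgroup.centralizer ({(g : G)} : Set G) := fun y => by
        have h1 := hmem (p y)
        rwa [show (p y).1.1.1.1 = g from congrArg Sigma.fst (congrFun hpq y)] at h1
      refine ⟨g, fun y => (⟨_, hm y⟩, q y), ⟨hk.1.1, hq⟩, funext fun y => ?_⟩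
      have h6 : ∀ a b : (fixedPointUnion G M R).Arr,
          (⟨a.1, a.2.2⟩ : (fixedPointUnion G M R).Obj) = ⟨b.1, b.2.2⟩ →
          (a.2.1 : G) = b.2.1 → a = b := by
        rintro ⟨i, z, x⟩ ⟨j, w, x'⟩ h h'
        obtain ⟨rfl, h⟩ := Sigma.mk.inj h
        obtain rfl := eq_of_heq h
        obtain rfl := Subtype.ext h'
        rfl
      exact h6 _ _ (congrFun hpq y) rfl

/-- The map from the disjoint union of the orbit spaces of the groupoids `Z(g) ⋉ M^g` to the orbit
space of the inertia groupoid induced by `fixedPointHom`. -/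
def orbitMap (z : Σ g : R, (fixedPointGroupoid G M g).OrbitSpace) :
    (ofAction G M).inertia.OrbitSpace :=
  Quotient.lift (fun x => (ofAction G M).inertia.toOrbit ((fixedPointHom R).obj ⟨z.1, x⟩))
    (by
      rintro _ _ ⟨a, rfl, rfl⟩
      refine Quotient.sound ⟨(fixedPointHom R).arr ⟨z.1, a⟩, (fixedPointHom R).src_arr _,
        (fixedPointHom R).tgt_arr _⟩) z.2

lemma orbitMap_eq_toOrbit_conjLoop (z : Σ g : R, MulAction.fixedBy M (g : G) × G) :
    orbitMap R ⟨z.1, (fixedPointGroupoid G M z.1).toOrbit z.2.1⟩ =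
      (ofAction G M).inertia.toOrbit (conjLoop R z) :=
  Quotient.sound ⟨⟨((z.2.2, z.2.1.1), ⟨(z.1, z.2.1.1), z.2.1.2.symm⟩), rfl⟩, rfl, rfl⟩

lemma continuous_orbitMap : Continuous (orbitMap (M := M) R) := by
  refine continuous_sigma fun g => continuous_coinduced_dom.mpr ?_
  refine (continuous_toOrbit _).comp (Continuous.subtype_mk ?_ _)
  fun_prop

/-- Injectivity again uses that an arrow between loops over `R` fixes the index and centralises it;
surjectivity is that of `conjLoop`. -/
lemma bijective_orbitMap (hR : ∀ g : G, ∃! r : G, r ∈ R ∧ IsConj r g) :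
    Function.Bijective (orbitMap (M := M) R) := by
  constructor
  · rintro ⟨r, ⟨x⟩⟩ ⟨r', ⟨x'⟩⟩ h
    obtain ⟨⟨⟨⟨k, y⟩, δ⟩, hδ⟩, h1, h2⟩ := Quotient.exact h
    subst h1
    obtain rfl : y = x := hδ
    have h3 : (r' : G) = k * r * k⁻¹ := (congrArg (fun a => a.1.1) h2).symm
    obtain rfl := eq_of_eq_conj hR h3
    have hk : k ∈ Subgroup.centralizer ({(r : G)} : Set G) := by
      rw [eq_comm, mul_inv_eq_iff_eq_mul] at h3
      exact Subgroup.mem_centralizer_singleton_iff.mpr h3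
    refine Sigma.ext rfl (heq_of_eq (Quotient.sound ⟨(⟨k, hk⟩, x), rfl, Subtype.ext ?_⟩))
    exact congrArg (fun a => a.1.2) h2
  · rintro ⟨a⟩
    obtain ⟨z, rfl⟩ := surjective_conjLoop R hR a
    exact ⟨_, orbitMap_eq_toOrbit_conjLoop R z⟩

/-- The homeomorphism between the orbit spaces. -/
lemma exists_orbitHomeomorph (hG : IsSmoothManifold G) [CompactSpace G]
    (hM : ∀ g : G, IsSmoothManifold (MulAction.fixedBy M g))
    (hL : IsSmoothManifold (ofAction G M).Loops)
    (hmul : DSmooth fun z : G × G => z.1 * z.2)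
    (hinv : DSmooth fun g : G => g⁻¹) (hsmul : DSmooth fun z : G × M => z.1 • z.2)
    (hσ : HasLocalConjugators G M) (hR : ∀ g : G, ∃! r : G, r ∈ R ∧ IsConj r g) :
    ∃ h : (ofAction G M).inertia.OrbitSpace ≃ₜ Σ g : R, (fixedPointGroupoid G M g).OrbitSpace,
      ∀ (g : R) (x : MulAction.fixedBy M (g : G)),
        h ((ofAction G M).inertia.toOrbit ((fixedPointHom R).obj ⟨g, x⟩)) =
          ⟨g, (fixedPointGroupoid G M g).toOrbit x⟩ := by
  have := fun g => (hM g).paracompact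
  have hN : IsSmoothManifold (Σ g : R, MulAction.fixedBy M (g : G) × G) :=
    .sigma fun g => (hM g).prod hG inferInstance
  let e := Equiv.ofBijective _ (bijective_orbitMap (M := M) R hR)
  have he : ∀ z : Σ g : R, MulAction.fixedBy M (g : G) × G,
      e.symm ((ofAction G M).inertia.toOrbit (conjLoop R z)) =
        ⟨z.1, (fixedPointGroupoid G M z.1).toOrbit z.2.1⟩ := fun z =>
    e.symm_apply_eq.mpr (orbitMap_eq_toOrbit_conjLoop R z).symm
  have hq : Continuous fun z : Σ g : R, MulAction.fixedBy M (g : G) × G =>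
      (⟨z.1, (fixedPointGroupoid G M z.1).toOrbit z.2.1⟩ :
        Σ g : R, (fixedPointGroupoid G M g).OrbitSpace) :=
    continuous_sigma fun g => continuous_sigmaMk.comp 
      ((continuous_toOrbit (fixedPointGroupoid G M g)).comp continuous_fst)
  have hc : Continuous e.symm := by
    -- Near each loop the inverse is a local section of `conjLoop` followed by the continuous
    -- projection to `⊔ |Z(g) ⋉ M^g|`.
    refine continuous_coinduced_dom.mpr (continuous_iff_continuousAt.mpr fun a => ?_)
    obtain ⟨z, rfl⟩ := surjective_conjLoop R hR a
    obtain ⟨V, s, hV, hs, -, hts⟩ := exists_local_section_conjLoop R hmul hinv hsmul hσ z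
    refine (hq.continuousAt.comp (hs.continuousAt hL hN hV)).congr ?_
    filter_upwards [hV] with b hb
    have h1 := he (s b)
    rw [hts b hb] at h1
    exact h1.symm
  refine ⟨⟨e.symm, hc, continuous_orbitMap R⟩, fun g x => ?_⟩
  exact e.symm_apply_eq.mpr rfl

end FixedPoints

end DiffGroupoid

end

/-! ### The proposition -/

theorem mainTheorem6
    {E : Type*} [NormedAddCommGroup E] [NormedSpace ℝ E] [FiniteDimensional ℝ E]
    {F : Type*} [NormedAddCommGroup F] [NormedSpace ℝ F] [FiniteDimensional ℝ F]
    {G : Type*} [Group G] [TopologicalSpace G] [ChartedSpace E G] [LieGroup 𝓘(ℝ, E) ∞ G]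
    [CompactSpace G] [T2Space G]
    {M : Type*} [TopologicalSpace M] [ChartedSpace F M] [IsManifold 𝓘(ℝ, F) ∞ M]
    [T2Space M] [ParacompactSpace M]
    [MulAction G M] [ContMDiffSMul 𝓘(ℝ, E) 𝓘(ℝ, F) ∞ G M]
    (almostFree : ∀ x : M, Finite (MulAction.stabilizer G x))
    (R : Set G) (hR : ∀ g : G, ∃! r : G, r ∈ R ∧ IsConj r g) :
    letI : DiffeologicalSpace G := manifoldDiffeology E G
    letI : DiffeologicalSpace M := manifoldDiffeology F M
    (DiffGroupoid.ofAction G M).inertia.IsLie ∧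
    (DiffGroupoid.disjointUnion fun g : R => DiffGroupoid.fixedPointGroupoid G M g).IsLie ∧
    ∃ φ : DiffGroupoid.Hom
        (DiffGroupoid.disjointUnion fun g : R => DiffGroupoid.fixedPointGroupoid G M g)
        (DiffGroupoid.ofAction G M).inertia,
      φ.IsWeakEquivalence ∧
      ∃ h : (DiffGroupoid.ofAction G M).inertia.OrbitSpace ≃ₜ
          Σ g : R, (DiffGroupoid.fixedPointGroupoid G M g).OrbitSpace,
        ∀ (g : R) (x : MulAction.fixedBy M (g : G)),
          h ((DiffGroupoid.ofAction G M).inertia.toOrbit (φ.obj (Sigma.mk g x))) =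
            ⟨g, (DiffGroupoid.fixedPointGroupoid G M g).toOrbit x⟩ := by
  let := manifoldDiffeology E G
  let := manifoldDiffeology F M
  have hG : IsSmoothManifold G := isSmoothManifold_manifoldDiffeology (E := E)
  have hsmulM := ContMDiffSMul.contMDiff_smul (I := 𝓘(ℝ, E)) (I' := 𝓘(ℝ, F)) (n := ∞)
    (G := G) (M := M)
  have : ContinuousSMul G M := ⟨hsmulM.continuous⟩
  have : IsTopologicalGroup G := topologicalGroup_of_lieGroup 𝓘(ℝ, E) ∞
  have hmul : DSmooth fun z : G × G => z.1 * z.2 := fun n p hp =>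
    (contMDiff_mul 𝓘(ℝ, E) ∞).contMDiffOn.dSmoothOn_prod n p hp fun y => mem_univ (p y)
  have hinv : DSmooth fun g : G => g⁻¹ := fun n p hp =>
    (contMDiff_inv 𝓘(ℝ, E) ∞).contMDiffOn.dSmoothOn n p hp fun y => mem_univ (p y)
  have hsmul : DSmooth fun z : G × M => z.1 • z.2 := fun n p hp =>
    hsmulM.contMDiffOn.dSmoothOn_prod n p hp fun y => mem_univ (p y)
  have hL : IsSmoothManifold (DiffGroupoid.ofAction G M).Loops :=
    isSmoothManifold_loops almostFree
  have hσ : DiffGroupoid.HasLocalConjugators G M := exists_loop_conjugator almostFree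
  have hfix : ∀ g : G, IsSmoothManifold (MulAction.fixedBy M g) ∧
      (DiffGroupoid.fixedPointGroupoid G M g).IsLie := by
    intro g
    -- An element without fixed points may have infinite order, but then there are no objects or
    -- arrows and nothing is needed about its centraliser. A fixed point forces finite order.
    rcases isEmpty_or_nonempty (MulAction.fixedBy M g) with h | ⟨⟨x, hx⟩⟩
    · exact ⟨.of_isEmpty, DiffGroupoid.isLie_fixedPointGroupoid g .of_isEmpty .of_isEmpty
        hmul hinv hsmul⟩
    · obtain ⟨n, hn, hg⟩ := exists_pow_eq_one_of_smul_eq (almostFree x) hx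
      have hM : IsSmoothManifold (MulAction.fixedBy M g) := isSmoothManifold_fixedBy E g hn hg
      have hZ : IsSmoothManifold (Subgroup.centralizer ({g} : Set G)) :=
        isSmoothManifold_centralizer g hn hg
      -- The centraliser is closed in a compact group, hence compact, which makes the arrow space
      -- paracompact.
      have hcl : IsClosed (Subgroup.centralizer ({g} : Set G) : Set G) := by
        have : (Subgroup.centralizer ({g} : Set G) : Set G) = {k | k * g = g * k} :=
          Set.ext fun k => Subgroup.mem_centralizer_singleton_iff
        rw [this]
        exact isClosed_eq (by fun_prop) (by fun_prop)
      have : CompactSpace (Subgroup.centralizer ({g} : Set G)) :=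
        isCompact_iff_compactSpace.mp hcl.isCompact
      have := hM.paracompact
      exact ⟨hM, DiffGroupoid.isLie_fixedPointGroupoid g hM (hZ.prod hM inferInstance)
        hmul hinv hsmul⟩
  exact ⟨DiffGroupoid.isLie_inertia_ofAction hG hL hmul hinv hsmul,
    DiffGroupoid.isLie_fixedPointUnion R fun g _ => (hfix g).2,
    DiffGroupoid.fixedPointHom R,
    DiffGroupoid.isWeakEquivalence_fixedPointHom R hG (fun g => (hfix g).1) hL hmul hinv hsmul
      hσ hR,
    DiffGroupoid.exists_orbitHomeomorph R hG (fun g => (hfix g).1) hL hmul hinv hsmul hσ hR⟩
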